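/- Let $\mathbb{k}$ be an algebraically closed field of characteristic zero and let $n \le m$ be natural numbers. Let $\mathrm{SSYT}_m^n$ be the set of semistandard Young tableaux of all partition shapes with at most $n$ rows and with entries in $\{1,\dots,m\}$. For tableaux $T$, $T'$ of shapes $\lambda$, $\mu$, let $T \star T'$ be the semistandard tableau of shape $\lambda+\mu$ obtained by concatenating the rows of $T$ and $T'$ and sorting each row weakly increasingly; this makes $\mathrm{SSYT}_m^n$ a commutative monoid whose unit is the empty tableau. Let $A$ be its monoid algebra over $\mathbb{k}$ (the tableaux algebra), graded by the number of columns, and let $G \subseteq \mathrm{SSYT}_m^n$ be the set of tableaux with exactly one column. Then: 1. The graded algebra $A$ is Koszul: $A_0 = \mathbb{k}$, and the trivial module $\mathbb{k} = A/A_{+}$ has a linear graded free resolution, i.e. an exact sequence $\cdots \to P_2 \to P_1 \to P_0 \to \mathbb{k} \to 0$ of graded $A$-modules and maps of degree zero such that each $P_i$ is free on generators of degree $i$. 2. $A$ is quadratic on its column generators: $G$ is finite and generates $A$, and the kernel of the canonical map from the free algebra $\mathbb{k}\langle G\rangle$ onto $A$ is the two-sided ideal generated by the binomials $T_1 \otimes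 T_2 - T_3 \otimes T_4$ with $T_i \in G$ and $T_1 \star T_2 = T_3 \star T_4$ (in particular by the commutation relations $T_1\otimes T_2 - T_2\otimes T_1$ and the product relations). 3. $A$ is a PBW algebra on the generators $G$: there is a total order on $G$ such that the following holds. Call a pair $(C, C') \in G^2$ normal if the product $C \star C'$ is not in $A$ a linear combination of products $D \star D'$ with $(D, D') \in G^2$ lexicographically smaller than $(C, C')$. Then the products $C_1 \star \cdots \star C_r$ over all words $(C_1,\dots,C_r)$, $r \ge 0$, in $G$ in which every consecutive pair $(C_i, C_{i+1})$ is normal (different words being counted separately) form a $\mathbb{k}$-basis of $A$. 4. $A$ is G-quadratic on the generators $G$: for some monomial order, the kernel of the canonical surjection from the polynomial ring $\mathbb{k}[G]$ onto $A$ has a Gröbner basis consisting of homogeneous polynomials of degree two. -/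

import Mathlib

universe u v w

/-! ### Semistandard Young tableaux and the star product -/

/-- The set `SSYT_m^n` of semistandard Young tableaux of arbitrary partition shape with at most `n`
rows and with entries in `{1, …, m}` (rows and columns of a diagram are indexed from `0`). -/
structure SSYT (n m : ℕ) where
  shape : YoungDiagram
  tab : SemistandardYoungTableau shape
  row_lt : ∀ i j : ℕ, (i, j) ∈ shape → i < n
  entry_mem : ∀ i j : ℕ, (i, j) ∈ shape → 1 ≤ tab i j ∧ tab i j ≤ m

namespace SSYT

variable {n m : ℕ}

/-- The `i`-th row of a tableau, as the list of its entries from left to right. -/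
def row (T : SSYT n m) (i : ℕ) : List ℕ :=
  (List.range (T.shape.rowLen i)).map (T.tab i)

/-- The number of columns, i.e. the first part `λ₁` of the shape. -/
def numCols (T : SSYT n m) : ℕ := T.shape.rowLen 0

/-- Concatenate the `i`-th rows of two tableaux and sort the result weakly increasingly. -/
def starRow (T T' : SSYT n m) (i : ℕ) : List ℕ :=
  (T.row i ++ T'.row i).insertionSort (· ≤ ·)

/-- The sum `λ + μ` of two partitions, row by row. -/
def addShape (μ ν : YoungDiagram) : YoungDiagram where
  cells := (Finset.range (μ.colLen 0 + ν.colLen 0) ×ˢ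
    Finset.range (μ.rowLen 0 + ν.rowLen 0)).filter fun c => c.2 < μ.rowLen c.1 + ν.rowLen c.1
  isLowerSet := by
    rintro ⟨i, j⟩ ⟨i', j'⟩ h hc
    obtain ⟨hi, hj⟩ := Prod.mk_le_mk.1 h
    have h1 := μ.rowLen_anti _ _ hi
    have h2 := ν.rowLen_anti _ _ hi
    simp only [Finset.coe_filter, Finset.mem_product, Finset.mem_range, Set.mem_ofPred_eq] at hc ⊢
    omega

theorem mem_addShape {μ ν : YoungDiagram} {i j : ℕ} :
    (i, j) ∈ addShape μ ν ↔ j < μ.rowLen i + ν.rowLen i := by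
  rw [← YoungDiagram.mem_cells]
  simp only [addShape, Finset.mem_filter, Finset.mem_product, Finset.mem_range]
  refine ⟨fun h => h.2, fun h => ⟨⟨?_, ?_⟩, h⟩⟩
  · by_contra hc
    have key : ∀ ρ : YoungDiagram, ρ.colLen 0 ≤ i → ρ.rowLen i = 0 := by
      intro ρ hρ
      by_contra h0
      have h1 : (i, 0) ∈ ρ := YoungDiagram.mem_iff_lt_rowLen.2 (Nat.pos_of_ne_zero h0)
      have h2 := YoungDiagram.mem_iff_lt_colLen.1 h1
      omega
    have := key μ (by omega)
    have := key ν (by omega)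
    omega
  · have h1 := μ.rowLen_anti 0 i (Nat.zero_le _)
    have h2 := ν.rowLen_anti 0 i (Nat.zero_le _)
    omega

theorem rowLen_eq_of {μ : YoungDiagram} {i c : ℕ} (h : ∀ j, (i, j) ∈ μ ↔ j < c) :
    μ.rowLen i = c := by
  have h1 := fun j => (YoungDiagram.mem_iff_lt_rowLen (μ := μ) (i := i) (j := j)).symm.trans (h j)
  have h2 := h1 c
  have h3 := h1 (μ.rowLen i)
  omega

theorem rowLen_addShape (μ ν : YoungDiagram) (i : ℕ) :
    (addShape μ ν).rowLen i = μ.rowLen i + ν.rowLen i :=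
  rowLen_eq_of fun _ => mem_addShape

theorem length_row (T : SSYT n m) (i : ℕ) : (T.row i).length = T.shape.rowLen i := by
  simp [row]

theorem getElem_row (T : SSYT n m) (i j : ℕ) (h : j < (T.row i).length) :
    (T.row i)[j] = T.tab i j := by
  simp [row]

theorem pairwise_row (T : SSYT n m) (i : ℕ) : (T.row i).Pairwise (· ≤ ·) := by
  rw [List.pairwise_iff_getElem]
  intro a b ha hb hab
  rw [getElem_row, getElem_row]
  exact T.tab.row_weak hab (YoungDiagram.mem_iff_lt_rowLen.2 (by rwa [length_row] at hb))

theorem mem_row (T : SSYT n m) {i x : ℕ} (h : x ∈ T.row i) : i < n ∧ 1 ≤ x ∧ x ≤ m := by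
  simp only [row, List.mem_map, List.mem_range] at h
  obtain ⟨j, hj, rfl⟩ := h
  have := YoungDiagram.mem_iff_lt_rowLen.2 hj
  exact ⟨T.row_lt _ _ this, T.entry_mem _ _ this⟩

theorem ext_row {T T' : SSYT n m} (h : ∀ i, T.row i = T'.row i) : T = T' := by
  have hs : T.shape = T'.shape := by
    apply YoungDiagram.ext
    ext ⟨i, j⟩
    rw [YoungDiagram.mem_cells, YoungDiagram.mem_cells, YoungDiagram.mem_iff_lt_rowLen,
      YoungDiagram.mem_iff_lt_rowLen, ← length_row, ← length_row, h i]
  have he : ∀ i j, (i, j) ∈ T.shape → T.tab i j = T'.tab i j := by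
    intro i j hij
    have h1 : j < (T.row i).length := by
      rw [length_row]; exact YoungDiagram.mem_iff_lt_rowLen.1 hij
    have h2 : j < (T'.row i).length := by rw [← h i]; exact h1
    rw [← getElem_row T i j h1, ← getElem_row T' i j h2]
    simp only [h i]
  obtain ⟨μ, t, _, _⟩ := T
  obtain ⟨μ', t', _, _⟩ := T'
  simp only at hs he
  subst hs
  have : t = t' := by
    ext i j
    by_cases hij : (i, j) ∈ μ
    · exact he i j hij
    · rw [t.zeros hij, t'.zeros hij]
  subst this
  rfl

theorem ext_perm {T T' : SSYT n m} (h : ∀ i, (T.row i).Perm (T'.row i)) : T = T' :=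
  ext_row fun i => (h i).eq_of_pairwise' (T.pairwise_row i) (T'.pairwise_row i)

theorem sorted_getElem_iff {l : List ℕ} (hl : l.Pairwise (· ≤ ·)) (v : ℕ) {j : ℕ}
    (hj : j < l.length) : l[j] < v ↔ j < l.countP (· < v) := by
  induction l generalizing j with
  | nil => simp at hj
  | cons a l ih =>
    rw [List.pairwise_cons] at hl
    by_cases ha : a < v
    · cases j with
      | zero => simp [ha]
      | succ j =>
        have := ih hl.2 (by simpa using hj)
        simp only [List.getElem_cons_succ, List.countP_cons, ha, decide_true, if_true]
        omega
    · have h0 : (a :: l).countP (· < v) = 0 := by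
        rw [List.countP_eq_zero]
        intro x hx
        rcases List.mem_cons.1 hx with rfl | hx
        · simpa using ha
        · have := hl.1 x hx
          simp only [decide_eq_true_eq]; omega
      have h1 : a ≤ (a :: l)[j] := by
        cases j with
        | zero => simp
        | succ j => exact hl.1 _ (by simp)
      rw [h0]; omega

theorem countP_row_le (T : SSYT n m) {i i' : ℕ} (hi : i < i') (v : ℕ) :
    (T.row i').countP (· < v + 1) ≤ (T.row i).countP (· < v) := by
  by_contra hc
  push Not at hc
  set c := (T.row i).countP (· < v) with hcdef
  have hlen' : c < (T.row i').length := lt_of_lt_of_le hc List.countP_le_length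
  have h1 := (sorted_getElem_iff (T.pairwise_row i') (v + 1) hlen').2 hc
  have hmem : (i', c) ∈ T.shape :=
    YoungDiagram.mem_iff_lt_rowLen.2 (by rwa [length_row] at hlen')
  have hlen : c < (T.row i).length := by
    rw [length_row]
    exact YoungDiagram.mem_iff_lt_rowLen.1 (T.shape.up_left_mem hi.le le_rfl hmem)
  have h2 : ¬ (T.row i)[c] < v := by
    rw [sorted_getElem_iff (T.pairwise_row i) v hlen]; omega
  rw [getElem_row] at h1 h2
  have := T.tab.col_strict hi hmem
  omega

theorem pairwise_starRow (T T' : SSYT n m) (i : ℕ) : (starRow T T' i).Pairwise (· ≤ ·) :=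
  List.pairwise_insertionSort _ _

theorem length_starRow (T T' : SSYT n m) (i : ℕ) :
    (starRow T T' i).length = T.shape.rowLen i + T'.shape.rowLen i := by
  simp [starRow, length_row]

theorem perm_starRow (T T' : SSYT n m) (i : ℕ) :
    (starRow T T' i).Perm (T.row i ++ T'.row i) :=
  List.perm_insertionSort _ _

theorem mem_starRow (T T' : SSYT n m) {i x : ℕ} (h : x ∈ starRow T T' i) :
    i < n ∧ 1 ≤ x ∧ x ≤ m := by
  rw [(perm_starRow T T' i).mem_iff, List.mem_append] at h
  exact h.elim T.mem_row T'.mem_row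

/-- The star product `T ⋆ T'`: the tableau of shape `λ + μ` whose `i`-th row is the sorted
concatenation of the `i`-th rows of `T` and `T'`. -/
def star (T T' : SSYT n m) : SSYT n m where
  shape := addShape T.shape T'.shape
  tab :=
    { entry := fun i j => (starRow T T' i).getD j 0
      row_weak' := by
        intro i j1 j2 hj h
        rw [mem_addShape, ← length_starRow] at h
        rw [List.getD_eq_getElem _ _ h, List.getD_eq_getElem _ _ (hj.trans h)]
        exact List.pairwise_iff_getElem.1 (pairwise_starRow T T' i) _ _ _ _ hj
      col_strict' := by
        intro i1 i2 j hi h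
        have h' := (addShape T.shape T'.shape).up_left_mem hi.le le_rfl h
        rw [mem_addShape, ← length_starRow] at h h'
        rw [List.getD_eq_getElem _ _ h, List.getD_eq_getElem _ _ h',
          sorted_getElem_iff (pairwise_starRow T T' i1)]
        have h1 := (sorted_getElem_iff (pairwise_starRow T T' i2)
          ((starRow T T' i2)[j] + 1) h).1 (Nat.lt_succ_self _)
        rw [(perm_starRow T T' _).countP_eq, List.countP_append] at h1 ⊢
        have h2 := T.countP_row_le hi (starRow T T' i2)[j]
        have h3 := T'.countP_row_le hi (starRow T T' i2)[j]
        omega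
      zeros' := by
        intro i j h
        rw [mem_addShape, ← length_starRow] at h
        exact List.getD_eq_default _ _ (by omega) }
  row_lt := by
    intro i j h
    rw [mem_addShape, ← length_starRow] at h
    exact (mem_starRow T T' (List.getElem_mem h)).1
  entry_mem := by
    intro i j h
    rw [mem_addShape, ← length_starRow] at h
    have := (mem_starRow T T' (List.getElem_mem h)).2
    change 1 ≤ (starRow T T' i).getD j 0 ∧ (starRow T T' i).getD j 0 ≤ m
    rwa [List.getD_eq_getElem _ _ h]

theorem row_star (T T' : SSYT n m) (i : ℕ) : (star T T').row i = starRow T T' i := by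
  apply List.ext_getElem
  · rw [length_row, length_starRow]; exact rowLen_addShape _ _ _
  · intro j h1 h2
    rw [getElem_row]
    exact List.getD_eq_getElem _ _ h2

theorem row_star_perm (T T' : SSYT n m) (i : ℕ) :
    ((star T T').row i).Perm (T.row i ++ T'.row i) := by
  rw [row_star]; exact perm_starRow T T' i

/-- The empty tableau. -/
def empty (n m : ℕ) : SSYT n m where
  shape := ⊥
  tab := SemistandardYoungTableau.highestWeight ⊥
  row_lt := fun _ _ h => absurd h (YoungDiagram.notMem_bot _)
  entry_mem := fun _ _ h => absurd h (YoungDiagram.notMem_bot _)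

theorem rowLen_empty (i : ℕ) : (empty n m).shape.rowLen i = 0 :=
  rowLen_eq_of fun j => iff_of_false (YoungDiagram.notMem_bot _) (Nat.not_lt_zero j)

theorem row_empty (i : ℕ) : (empty n m).row i = [] :=
  List.eq_nil_of_length_eq_zero (by rw [length_row, rowLen_empty])

instance instAdd (n m : ℕ) : Add (SSYT n m) := ⟨star⟩

instance instZero (n m : ℕ) : Zero (SSYT n m) := ⟨empty n m⟩

/-- The commutative monoid `(SSYT_m^n, ⋆, ∅)`. It is written additively, `T + T'` being `T ⋆ T'`
and `0` the empty tableau, so that its monoid algebra is an `AddMonoidAlgebra`. -/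
instance instAddCommMonoid (n m : ℕ) : AddCommMonoid (SSYT n m) where
  add_assoc a b c := ext_perm fun i => by
    refine (row_star_perm (star a b) c i).trans (.trans ?_ (row_star_perm a (star b c) i).symm)
    refine ((row_star_perm a b i).append_right _).trans ?_
    rw [List.append_assoc]
    exact ((row_star_perm b c i).append_left _).symm
  zero_add a := ext_perm fun i => by
    refine (row_star_perm (empty n m) a i).trans ?_
    rw [row_empty, List.nil_append]
  add_zero a := ext_perm fun i => by
    refine (row_star_perm a (empty n m) i).trans ?_
    rw [row_empty, List.append_nil]
  add_comm a b := ext_perm fun i =>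
    (row_star_perm a b i).trans (List.perm_append_comm.trans (row_star_perm b a i).symm)
  nsmul := nsmulRec

/-- The number of columns is additive for the star product. -/
def numColsHom (n m : ℕ) : SSYT n m →+ ℕ where
  toFun := numCols
  map_zero' := rowLen_empty 0
  map_add' T T' := rowLen_addShape T.shape T'.shape 0

end SSYT

/-- The column tableaux: the tableaux of shape `(1^k)` with `1 ≤ k ≤ n`, that is, with exactly one
column. -/
def TableauColumn (n m : ℕ) : Type := {T : SSYT n m // T.numCols = 1}

/-- The tableaux algebra: the monoid algebra over `k` of `(SSYT_m^n, ⋆, ∅)`. -/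
abbrev TableauxAlgebra (k : Type u) [Field k] (n m : ℕ) : Type u :=
  AddMonoidAlgebra k (SSYT n m)

/-- A column, as an element of the tableaux algebra. -/
noncomputable def columnGen (k : Type u) [Field k] (n m : ℕ) (C : TableauColumn n m) :
    TableauxAlgebra k n m :=
  AddMonoidAlgebra.single C.1 1

/-- The grading of the tableaux algebra in which the columns have degree one: the part of degree
`d` is spanned by the tableaux with exactly `d` columns. -/
abbrev columnGrading (k : Type u) [Field k] (n m : ℕ) :
    ℕ → Submodule k (TableauxAlgebra k n m) :=
  AddMonoidAlgebra.gradeBy k (SSYT.numColsHom n m)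

/-- The quadratic binomials `T₁ ⊗ T₂ - T₃ ⊗ T₄` in the free algebra on the columns, for all columns
with `T₁ ⋆ T₂ = T₃ ⋆ T₄`. The commutation relations `T₁ ⊗ T₂ - T₂ ⊗ T₁` are among them. -/
def columnRelations (k : Type u) [Field k] (n m : ℕ) : Set (FreeAlgebra k (TableauColumn n m)) :=
  {r | ∃ C₁ C₂ C₃ C₄ : TableauColumn n m, C₁.1 + C₂.1 = C₃.1 + C₄.1 ∧
    r = FreeAlgebra.ι k C₁ * FreeAlgebra.ι k C₂ - FreeAlgebra.ι k C₃ * FreeAlgebra.ι k C₄}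

/-! ### Quadratic, PBW, G-quadratic and Koszul algebras -/

section General

variable (k : Type u) [Field k]

/-- `x` is a finite family of generators of the `k`-algebra `A` whose relations are generated, as a
two-sided ideal of the free algebra, by a set `R` of homogeneous elements of degree two. -/
def IsQuadraticPresentation {A : Type v} [Ring A] [Algebra k A] {X : Type w} (x : X → A) : Prop :=
  Finite X ∧ Function.Surjective (FreeAlgebra.lift k x) ∧
    ∃ R : Set (FreeAlgebra k X),
      (∀ r ∈ R, r ∈ Submodule.span k
        {t | ∃ a b : X, t = FreeAlgebra.ι k a * FreeAlgebra.ι k b}) ∧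
      TwoSidedIdeal.ker (FreeAlgebra.lift k x) = TwoSidedIdeal.span R

/-- The pair `(a, b)` is normal: `x a * x b` is not a linear combination of products `x c * x d` with
`(c, d)` lexicographically smaller than `(a, b)`. -/
def IsNormalPair {A : Type v} [Ring A] [Algebra k A] {X : Type w} [LinearOrder X] (x : X → A)
    (a b : X) : Prop :=
  x a * x b ∉ Submodule.span k {t | ∃ c d : X, toLex (c, d) < toLex (a, b) ∧ t = x c * x d}

/-- The totally ordered family `x` is a family of PBW generators of `A`: it presents `A` as a
quadratic algebra, and the monomials all of whose pairs of consecutive letters are normal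
(the words of length at most one included) form a basis of `A`. -/
def IsPBWGenerators {A : Type v} [Ring A] [Algebra k A] {X : Type w} [LinearOrder X]
    (x : X → A) : Prop :=
  IsQuadraticPresentation k x ∧
    LinearIndependent k
      (fun s : {s : List X // s.IsChain (IsNormalPair k x)} => (s.1.map x).prod) ∧
    Submodule.span k
      (Set.range fun s : {s : List X // s.IsChain (IsNormalPair k x)} => (s.1.map x).prod) = ⊤

/-- The finite family `x` generates the commutative algebra `A`, and for some monomial order the
ideal of relations in the polynomial ring has a Gröbner basis `B` of quadratic forms. -/
def IsGQuadraticPresentation {A : Type v} [CommRing A] [Algebra k A] {X : Type w}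
    (x : X → A) : Prop :=
  Finite X ∧ Function.Surjective (MvPolynomial.aeval x : MvPolynomial X k →ₐ[k] A) ∧
    ∃ (o : MonomialOrder.{w, w} X) (B : Set (MvPolynomial X k)),
      (∀ f ∈ B, f ∈ RingHom.ker (MvPolynomial.aeval x : MvPolynomial X k →ₐ[k] A)) ∧
      (∀ f ∈ B, f.IsHomogeneous 2) ∧
      Ideal.span (o.leadingTerm '' B) = Ideal.span (o.leadingTerm ''
        {f | f ∈ RingHom.ker (MvPolynomial.aeval x : MvPolynomial X k →ₐ[k] A)})

variable {k}

/-- A graded algebra `A = ⨁ 𝒜 d` is Koszul if `𝒜 0 = k` and the module `k = A ⧸ A₊` has a linear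
graded free resolution: an exact sequence `⋯ → P₂ → P₁ → P₀ → k → 0` of graded modules and maps of
degree zero in which `P i` is free on generators of degree `i`. With `P i` free on the set `B i` of
generators of degree `i`, the differential has degree zero if and only if its matrix entries
lie in `𝒜 1`. -/
def IsKoszul {A : Type v} [CommRing A] [Algebra k A] (𝒜 : ℕ → Submodule k A)
    [GradedAlgebra 𝒜] : Prop :=
  Function.Injective (algebraMap k A) ∧ 𝒜 0 = 1 ∧
    ∃ (B : ℕ → Type v) (d : ∀ i, (B (i + 1) →₀ A) →ₗ[A] (B i →₀ A))
      (ε : (B 0 →₀ A) →ₗ[A] (A ⧸ (HomogeneousIdeal.irrelevant 𝒜).toIdeal)),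
      (∀ (i : ℕ) (b : B (i + 1)) (c : B i), d i (Finsupp.single b 1) c ∈ 𝒜 1) ∧
      Function.Surjective ε ∧
      Function.Exact (d 0) ε ∧
      ∀ i, Function.Exact (d (i + 1)) (d i)

end General

/-! Record the first column of a tableau as the function sending a row to its minimum, with `⊤` for
an empty row. The minimum of a union of multisets is the minimum of the minima, so this turns `⋆`
into the pointwise meet (`firstCol_add`), and a column is determined by its first column
(`firstCol_injective`). Since `⋆` is cancellative, every tableau is the product of exactly one chain
of columns for the rowwise order `Below` (`wordSum_colWord`, `colWord_wordSum_of_isChain`), and any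
two columns satisfy `C ⋆ D = (C ∧ D) ⋆ (C ∨ D)` (`meet_add_join`). Thus `A` behaves like a Hibi
ring: chains are the standard monomials and the straightening law is quadratic.

Quadratic relations and PBW basis: one pass of straightening inserts a column in front of a chain,
so the quadratic binomials reduce every word to its chain (`ι_mul_wordSection_single_sub_mem`). In a
linear extension of `Below`, the normal pairs are exactly the pairs in `Below`
(`isNormalPair_columnGen_iff`), so the normal words are the chains, that is, the tableaux.

Gröbner basis: for the reverse lexicographic order, the leading term of `CD - (C ∧ D)(C ∨ D)` with
`C`, `D` incomparable is `CD`. Distinct multichains have distinct products, so no leading monomial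
of the kernel is a multichain; each is divisible by some such `CD`.

Koszulness: the linear resolution is built directly by linear quotients. An ideal generated by a
lower set of columns consists of the elements whose tableaux all have their first column in that
set. If `S` is a lower set and `C ∈ S`, the colon by `C` of the ideal generated by the columns of
`S` smaller than `C` in the linear extension is generated by the columns `E` not above `C`, again a
lower set: `E ⋆ C = (C ∨ E) ⋆ (C ∧ E)` with `C ∧ E` in `S` and strictly smaller than `C`. Hence the
property "all leading coefficient ideals are generated by lower sets of columns, with linear lifts"
(`LinearSyzygies`) passes from a module to its syzygies (`headsIn_of_diff_eq_zero`,
`exists_lift_ker`), and iterating it from `A₊` gives the resolution. -/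

/-! ### Splitting off columns, cancellation, and first columns -/

namespace SSYT

variable {n m : ℕ}

/-- The tableau formed by (at most) `l` consecutive columns of `T`, starting with column `a`. -/
def slice (T : SSYT n m) (a l : ℕ) : SSYT n m where
  shape :=
    { cells := T.shape.cells.filter fun c => (c.1, a + c.2) ∈ T.shape ∧ c.2 < l
      isLowerSet := by
        rintro ⟨i, j⟩ ⟨i', j'⟩ h hc
        obtain ⟨hi, hj⟩ := Prod.mk_le_mk.1 h
        simp only [Finset.coe_filter, YoungDiagram.mem_cells, Set.mem_ofPred_eq] at hc ⊢
        exact ⟨T.shape.up_left_mem hi hj hc.1,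
          T.shape.up_left_mem hi (Nat.add_le_add_left hj a) hc.2.1, hj.trans_lt hc.2.2⟩ }
  tab :=
    { entry := fun i j => if (i, a + j) ∈ T.shape ∧ j < l then T.tab i (a + j) else 0
      row_weak' := by
        intro i j1 j2 hj h
        rw [← YoungDiagram.mem_cells, Finset.mem_filter] at h
        rw [if_pos h.2, if_pos ⟨T.shape.up_left_mem le_rfl (by omega) h.2.1, hj.trans h.2.2⟩]
        exact T.tab.row_weak (by omega) h.2.1
      col_strict' := by
        intro i1 i2 j hi h
        rw [← YoungDiagram.mem_cells, Finset.mem_filter] at h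
        rw [if_pos h.2, if_pos ⟨T.shape.up_left_mem hi.le le_rfl h.2.1, h.2.2⟩]
        exact T.tab.col_strict hi h.2.1
      zeros' := by
        intro i j h
        rw [← YoungDiagram.mem_cells, Finset.mem_filter] at h
        refine if_neg fun h' => h ⟨?_, h'⟩
        exact T.shape.up_left_mem le_rfl (Nat.le_add_left j a) h'.1 }
  row_lt := by
    intro i j h
    rw [← YoungDiagram.mem_cells, Finset.mem_filter] at h
    exact T.row_lt i _ h.2.1
  entry_mem := by
    intro i j h
    rw [← YoungDiagram.mem_cells, Finset.mem_filter] at h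
    change 1 ≤ ite _ _ _ ∧ ite _ _ _ ≤ m
    rw [if_pos h.2]
    exact T.entry_mem i _ h.2.1

theorem mem_slice {T : SSYT n m} {a l i j : ℕ} :
    (i, j) ∈ (T.slice a l).shape ↔ (i, a + j) ∈ T.shape ∧ j < l := by
  rw [← YoungDiagram.mem_cells]
  simp only [slice, Finset.mem_filter, YoungDiagram.mem_cells]
  exact ⟨fun h => h.2, fun h => ⟨T.shape.up_left_mem le_rfl (Nat.le_add_left j a) h.1, h⟩⟩

theorem rowLen_slice (T : SSYT n m) (a l i : ℕ) :
    (T.slice a l).shape.rowLen i = min l (T.shape.rowLen i - a) :=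
  rowLen_eq_of fun j => by
    rw [mem_slice, YoungDiagram.mem_iff_lt_rowLen]
    omega

theorem row_slice (T : SSYT n m) (a l i : ℕ) :
    (T.slice a l).row i = ((T.row i).drop a).take l := by
  apply List.ext_getElem
  · simp [length_row, rowLen_slice]
  · intro j h1 h2
    rw [getElem_row, List.getElem_take, List.getElem_drop, getElem_row]
    rw [length_row] at h1
    exact if_pos (mem_slice.1 (YoungDiagram.mem_iff_lt_rowLen.2 h1))

/-- The first column of a tableau. -/
def head (T : SSYT n m) (h : T.numCols ≠ 0) : TableauColumn n m :=
  ⟨T.slice 0 1, by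
    have := T.rowLen_slice 0 1 0
    unfold numCols at h ⊢
    omega⟩

/-- The tableau without its first column. -/
def tail (T : SSYT n m) : SSYT n m := T.slice 1 T.numCols

theorem row_add_perm (T T' : SSYT n m) (i : ℕ) :
    ((T + T').row i).Perm (T.row i ++ T'.row i) := row_star_perm T T' i

theorem numCols_add (T T' : SSYT n m) : (T + T').numCols = T.numCols + T'.numCols :=
  (numColsHom n m).map_add T T'

theorem numCols_zero : (0 : SSYT n m).numCols = 0 := (numColsHom n m).map_zero

theorem length_row_le_numCols (T : SSYT n m) (i : ℕ) : (T.row i).length ≤ T.numCols := by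
  rw [length_row]
  exact T.shape.rowLen_anti 0 i (Nat.zero_le _)

theorem head_add_tail (T : SSYT n m) (h : T.numCols ≠ 0) : (T.head h).1 + T.tail = T := by
  refine ext_perm fun i => (row_add_perm _ _ i).trans (List.Perm.of_eq ?_)
  simp only [head, tail, row_slice, List.drop_zero]
  rw [List.take_of_length_le (l := List.drop 1 (T.row i)), List.take_append_drop]
  have := T.length_row_le_numCols i
  simp only [List.length_drop]
  omega

theorem numCols_tail_add_one (T : SSYT n m) (h : T.numCols ≠ 0) :
    T.tail.numCols + 1 = T.numCols := by
  conv_rhs => rw [← T.head_add_tail h, numCols_add, (T.head h).2, add_comm]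

theorem eq_zero_of_numCols {T : SSYT n m} (h : T.numCols = 0) : T = 0 := by
  refine ext_row fun i => ?_
  have h1 := T.length_row_le_numCols i
  have h2 : (0 : SSYT n m).row i = [] := row_empty i
  rw [h2]
  exact List.eq_nil_of_length_eq_zero (by omega)

/-- A tableau is determined by the multisets of entries of its rows, and `⋆` adds these multisets;
multiset addition cancels. -/
instance : IsLeftCancelAdd (SSYT n m) :=
  ⟨fun a b c h => ext_perm fun i => by
    have h1 := (row_add_perm a b i).symm.trans
      ((List.Perm.of_eq (congrArg (fun T => T.row i) h)).trans (row_add_perm a c i))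
    exact (List.perm_append_left_iff _).1 h1⟩

instance : IsCancelAdd (SSYT n m) := AddCommMagma.IsLeftCancelAdd.toIsCancelAdd _

/-- The first column of a tableau, as the function that maps a row to its least entry,
which is `⊤` for an empty row. -/
noncomputable def firstCol (T : SSYT n m) (i : ℕ) : ℕ∞ :=
  (Multiset.map (fun x : ℕ => (x : ℕ∞)) (T.row i)).inf

/-- Sorting does not change the minimum of a row. This homomorphism to a semilattice drives all
later arguments. -/
theorem firstCol_add (T T' : SSYT n m) : (T + T').firstCol = T.firstCol ⊓ T'.firstCol := by
  funext i
  simp only [firstCol, Pi.inf_apply]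
  rw [Multiset.coe_eq_coe.2 (row_add_perm T T' i), ← Multiset.coe_add, Multiset.map_add,
    Multiset.inf_add]

theorem firstCol_zero : (0 : SSYT n m).firstCol = ⊤ := by
  funext i
  have h : (0 : SSYT n m).row i = [] := row_empty i
  simp [firstCol, h]

theorem firstCol_head (T : SSYT n m) (h : T.numCols ≠ 0) :
    (T.head h).1.firstCol = T.firstCol := by
  funext i
  have hs := T.pairwise_row i
  simp only [firstCol, head, row_slice, List.drop_zero]
  cases hr : T.row i with
  | nil => simp
  | cons a l =>
    rw [hr, List.pairwise_cons] at hs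
    simp only [List.take_succ_cons, List.take_zero]
    rw [← Multiset.cons_coe, ← Multiset.cons_coe, Multiset.map_cons, Multiset.map_cons,
      Multiset.inf_cons, Multiset.inf_cons]
    simp only [Multiset.coe_nil, Multiset.map_zero, Multiset.inf_zero, inf_top_eq]
    rw [eq_comm, inf_eq_left, Multiset.le_inf]
    intro b hb
    obtain ⟨x, hx, rfl⟩ := Multiset.mem_map.1 hb
    exact_mod_cast hs.1 x (Multiset.mem_coe.1 hx)

theorem firstCol_le_tail (T : SSYT n m) (h : T.numCols ≠ 0) :
    T.firstCol ≤ T.tail.firstCol := by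
  conv_lhs => rw [← T.head_add_tail h, firstCol_add]
  exact inf_le_right

end SSYT

/-! ### The lattice of columns -/

namespace TableauColumn

variable {n m : ℕ}

theorem row_eq (C : TableauColumn n m) (i : ℕ) : C.1.row i = [] ∨ ∃ x, C.1.row i = [x] := by
  have h := (C.1.length_row_le_numCols i).trans_eq C.2
  rcases Nat.le_one_iff_eq_zero_or_eq_one.1 h with h | h
  · exact Or.inl (List.eq_nil_of_length_eq_zero h)
  · exact Or.inr (List.length_eq_one_iff.1 h)

/-- Each row of a column has at most one entry, which its minimum recovers. -/
theorem firstCol_injective :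
    Function.Injective fun C : TableauColumn n m => C.1.firstCol := by
  intro C D h
  refine Subtype.ext (SSYT.ext_row fun i => ?_)
  have hi := congrFun h i
  simp only [SSYT.firstCol] at hi
  rcases C.row_eq i with hC | ⟨x, hC⟩ <;>
    rcases D.row_eq i with hD | ⟨y, hD⟩ <;>
    simp_all

theorem firstCol_injective_iff {C D : TableauColumn n m} :
    C.1.firstCol = D.1.firstCol ↔ C = D := firstCol_injective.eq_iff

theorem firstCol_ne_top (C : TableauColumn n m) : C.1.firstCol ≠ ⊤ := by
  intro h
  have h0 := congrFun h 0
  have hl : (C.1.row 0).length = 1 := (C.1.length_row 0).trans C.2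
  obtain ⟨x, hx⟩ := List.length_eq_one_iff.1 hl
  simp [SSYT.firstCol, hx] at h0

instance : Finite (TableauColumn n m) := by
  -- The value `0` encodes an empty row; it is free because entries are at least `1`. Rows from `n`
  -- on are empty.
  refine Finite.of_injective (β := Fin n → Fin (m + 1))
    (fun C i => ⟨((C.1.row i).headD 0), ?_⟩) ?_
  · cases h : C.1.row i with
    | nil => simp
    | cons a l =>
      have := (C.1.mem_row (i := i) (x := a) (by simp [h])).2.2
      simp only [List.headD_cons]
      omega
  · intro C D h
    refine Subtype.ext (SSYT.ext_row fun i => ?_)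
    have pos : ∀ (E : TableauColumn n m) (x : ℕ), E.1.row i = [x] → i < n ∧ 1 ≤ x :=
      fun E x hE => ⟨(E.1.mem_row (i := i) (x := x) (by simp [hE])).1,
        (E.1.mem_row (i := i) (x := x) (by simp [hE])).2.1⟩
    have key : ∀ hi : i < n, (C.1.row i).headD 0 = (D.1.row i).headD 0 := fun hi => by
      simpa using congrArg Fin.val (congrFun h ⟨i, hi⟩)
    rcases C.row_eq i with hC | ⟨x, hC⟩ <;>
      rcases D.row_eq i with hD | ⟨y, hD⟩
    · rw [hC, hD]
    · have h1 := pos D y hD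
      have h2 := key h1.1
      simp [hC, hD] at h2
      omega
    · have h1 := pos C x hC
      have h2 := key h1.1
      simp [hC, hD] at h2
      omega
    · have h1 := pos C x hC
      have h2 := key h1.1
      simp [hC, hD] at h2
      rw [hC, hD, h2]

/-- The lattice order on columns: row by row comparison, the empty positions counting as `∞`. It
holds if and only if the two columns form a tableau. -/
def Below (C D : TableauColumn n m) : Prop := C.1.firstCol ≤ D.1.firstCol

theorem Below.refl (C : TableauColumn n m) : Below C C := le_refl C.1.firstCol

theorem Below.trans {C D E : TableauColumn n m} (hCD : Below C D) (hDE : Below D E) : Below C E :=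
  le_trans (α := ℕ → ℕ∞) hCD hDE

/-- A linear extension of the lattice order on columns: compare at the topmost difference. -/
noncomputable instance : LinearOrder (TableauColumn n m) :=
  LinearOrder.lift' (fun C => toLex C.1.firstCol) fun _ _ h => firstCol_injective (toLex.injective h)

theorem Below.le {C D : TableauColumn n m} (h : Below C D) : C ≤ D :=
  Pi.toLex_monotone h

theorem numCols_add_ne_zero (C : TableauColumn n m) (T : SSYT n m) : (C.1 + T).numCols ≠ 0 := by
  rw [SSYT.numCols_add, C.2]
  omega

/-- The first column of the product of two columns. -/
def meet (C D : TableauColumn n m) : TableauColumn n m :=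
  (C.1 + D.1).head (C.numCols_add_ne_zero D.1)

/-- The second column of the product of two columns. -/
def join (C D : TableauColumn n m) : TableauColumn n m :=
  ⟨(C.1 + D.1).tail, by
    have := (C.1 + D.1).numCols_tail_add_one (C.numCols_add_ne_zero D.1)
    rw [SSYT.numCols_add, C.2, D.2] at this
    omega⟩

theorem meet_add_join (C D : TableauColumn n m) : (meet C D).1 + (join C D).1 = C.1 + D.1 :=
  SSYT.head_add_tail _ _

theorem firstCol_meet (C D : TableauColumn n m) :
    (meet C D).1.firstCol = C.1.firstCol ⊓ D.1.firstCol :=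
  (SSYT.firstCol_head _ _).trans (SSYT.firstCol_add _ _)

theorem meet_below_left (C D : TableauColumn n m) : Below (meet C D) C :=
  (firstCol_meet C D).trans_le inf_le_left

theorem meet_below_right (C D : TableauColumn n m) : Below (meet C D) D :=
  (firstCol_meet C D).trans_le inf_le_right

theorem meet_below_join (C D : TableauColumn n m) : Below (meet C D) (join C D) :=
  (SSYT.firstCol_head _ _).trans_le (SSYT.firstCol_le_tail _ (C.numCols_add_ne_zero D.1))

theorem meet_ne_left {C D : TableauColumn n m} (h : ¬ Below C D) : meet C D ≠ C := fun h' =>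
  h (by simpa only [h'] using meet_below_right C D)

theorem meet_ne_right {C D : TableauColumn n m} (h : ¬ Below D C) : meet C D ≠ D := fun h' =>
  h (by simpa only [h'] using meet_below_left C D)

/-- The first column of the product is the meet, here `C`, and it determines the head. With
`tail_add`, which follows by cancellation, this is the uniqueness of the factorization into a chain.
-/
theorem head_add (C : TableauColumn n m) (T : SSYT n m) (h : C.1.firstCol ≤ T.firstCol)
    (h' : (C.1 + T).numCols ≠ 0) : (C.1 + T).head h' = C :=
  firstCol_injective (by
    change ((C.1 + T).head h').1.firstCol = _
    rw [SSYT.firstCol_head, SSYT.firstCol_add, inf_eq_left.2 h])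

theorem tail_add (C : TableauColumn n m) (T : SSYT n m) (h : C.1.firstCol ≤ T.firstCol) :
    (C.1 + T).tail = T := by
  have h1 := (C.1 + T).head_add_tail (C.numCols_add_ne_zero T)
  rw [head_add C T h] at h1
  exact add_left_cancel h1

end TableauColumn

/-! ### Tableaux as chains of columns -/

namespace SSYT

variable {n m : ℕ}

/-- The list of the columns of a tableau, from left to right. -/
def colWord (T : SSYT n m) : List (TableauColumn n m) :=
  if h : T.numCols = 0 then [] else T.head h :: T.tail.colWord
termination_by T.numCols
decreasing_by
  have := T.numCols_tail_add_one h
  omega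

theorem colWord_zero : (0 : SSYT n m).colWord = [] := by
  rw [colWord, dif_pos numCols_zero]

theorem colWord_add (C : TableauColumn n m) (T : SSYT n m) (h : C.1.firstCol ≤ T.firstCol) :
    (C.1 + T).colWord = C :: T.colWord := by
  rw [colWord, dif_neg (C.numCols_add_ne_zero T), C.head_add T h, C.tail_add T h]

/-- Induction over the columns of a tableau, from right to left. -/
theorem colInduction {motive : SSYT n m → Prop} (zero : motive 0)
    (add : ∀ (C : TableauColumn n m) (T : SSYT n m), C.1.firstCol ≤ T.firstCol → motive T →
      motive (C.1 + T)) (T : SSYT n m) : motive T := by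
  induction hr : T.numCols generalizing T with
  | zero => exact eq_zero_of_numCols hr ▸ zero
  | succ r ih =>
    have h : T.numCols ≠ 0 := by omega
    have h1 := T.numCols_tail_add_one h
    have h2 := add (T.head h) T.tail ((T.firstCol_head h).trans_le (T.firstCol_le_tail h))
      (ih T.tail (by omega))
    rwa [head_add_tail] at h2

/-- The product of a list of columns. -/
def wordSum (l : List (TableauColumn n m)) : SSYT n m := (l.map fun C => C.1).sum

theorem wordSum_nil : wordSum ([] : List (TableauColumn n m)) = 0 := rfl

theorem wordSum_cons (C : TableauColumn n m) (l : List (TableauColumn n m)) :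
    wordSum (C :: l) = C.1 + wordSum l := List.sum_cons

theorem wordSum_colWord (T : SSYT n m) : wordSum T.colWord = T := by
  induction T using colInduction with
  | zero => rw [colWord_zero, wordSum_nil]
  | add C T h ih => rw [colWord_add C T h, wordSum_cons, ih]

/-- By transitivity the first letter of a chain lies below all others, hence below their meet. -/
theorem firstCol_wordSum_of_isChain (l : List (TableauColumn n m)) (C : TableauColumn n m)
    (h : (C :: l).IsChain TableauColumn.Below) :
    C.1.firstCol ≤ (wordSum l).firstCol := by
  induction l generalizing C with
  | nil => exact firstCol_zero (n := n) (m := m) ▸ le_top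
  | cons D l ih =>
    rw [List.isChain_cons_cons] at h
    rw [wordSum_cons, firstCol_add]
    exact le_inf h.1 (le_trans (α := ℕ → ℕ∞) h.1 (ih D h.2))

/-- Uniqueness of standard monomials; it yields the linear independence of the PBW monomials. -/
theorem colWord_wordSum_of_isChain (l : List (TableauColumn n m))
    (h : l.IsChain TableauColumn.Below) : (wordSum l).colWord = l := by
  induction l with
  | nil => exact colWord_zero
  | cons C l ih =>
    rw [wordSum_cons, colWord_add _ _ (firstCol_wordSum_of_isChain l C h),
      ih h.tail]

theorem isChain_colWord (T : SSYT n m) : T.colWord.IsChain TableauColumn.Below := by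
  induction T using colInduction with
  | zero => rw [colWord_zero]; exact List.IsChain.nil
  | add C T h ih =>
    rw [colWord_add C T h, List.isChain_cons]
    refine ⟨fun D hD => ?_, ih⟩
    rw [colWord] at hD
    split_ifs at hD with h0
    · simp at hD
    · simp only [List.head?_cons, Option.mem_some_iff] at hD
      exact h.trans_eq ((T.firstCol_head h0).symm.trans (by rw [hD]))

end SSYT

/-! ### Quadratic presentation and PBW basis -/

section Presentation

variable (k : Type u) [Field k] (n m : ℕ)

open AddMonoidAlgebra

theorem columnGen_mul_columnGen (C D : TableauColumn n m) :
    columnGen k n m C * columnGen k n m D = single (C.1 + D.1) 1 := by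
  rw [columnGen, columnGen, single_mul_single, one_mul]

theorem prod_map_columnGen (l : List (TableauColumn n m)) :
    (l.map (columnGen k n m)).prod = single (SSYT.wordSum l) 1 := by
  induction l with
  | nil => rfl
  | cons C l ih =>
    rw [List.map_cons, List.prod_cons, ih, columnGen, single_mul_single, one_mul, SSYT.wordSum_cons]

theorem single_eq_smul_prod (T : SSYT n m) (r : k) :
    (single T r : TableauxAlgebra k n m) = r • (T.colWord.map (columnGen k n m)).prod := by
  rw [prod_map_columnGen, SSYT.wordSum_colWord, smul_single', mul_one]

theorem lift_columnGen_surjective :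
    Function.Surjective (FreeAlgebra.lift k (columnGen k n m)) := by
  intro a
  induction a using AddMonoidAlgebra.induction_linear with
  | zero => exact ⟨0, map_zero _⟩
  | add a b ha hb =>
    obtain ⟨x, rfl⟩ := ha
    obtain ⟨y, rfl⟩ := hb
    exact ⟨x + y, map_add _ _ _⟩
  | single T r =>
    refine ⟨r • (T.colWord.map (FreeAlgebra.ι k)).prod, ?_⟩
    rw [map_smul, map_list_prod, List.map_map, single_eq_smul_prod]
    congr 3
    funext C
    exact FreeAlgebra.lift_ι_apply _ _

/-- The linear section of `k⟨G⟩ → A` that maps a tableau to the word of its columns. -/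
noncomputable def wordSection : TableauxAlgebra k n m →ₗ[k] FreeAlgebra k (TableauColumn n m) :=
  Finsupp.linearCombination k (fun T : SSYT n m => (T.colWord.map (FreeAlgebra.ι k)).prod) ∘ₗ
    (coeffLinearEquiv k).toLinearMap

theorem wordSection_single (T : SSYT n m) (r : k) :
    wordSection k n m (single T r) = r • (T.colWord.map (FreeAlgebra.ι k)).prod := by
  simp [wordSection]

/-- Straightening by insertion: in `C D T` with `D` the first column, replace `C D` by `E J`, where
`E` is the meet and `J` the join. Then `E` lies below both `J` and `T`, so it is the first letter of
the normal form, and it remains to insert `J` into the shorter `T`. -/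
theorem ι_mul_wordSection_single_sub_mem (C : TableauColumn n m) (T : SSYT n m) :
    FreeAlgebra.ι k C * wordSection k n m (single T 1) - wordSection k n m (single (C.1 + T) 1) ∈
      TwoSidedIdeal.span (columnRelations k n m) := by
  simp only [wordSection_single, one_smul]
  induction T using SSYT.colInduction generalizing C with
  | zero =>
    rw [SSYT.colWord_add C 0 (SSYT.firstCol_zero (n := n) (m := m) ▸ le_top), List.map_cons,
      List.prod_cons, sub_self]
    exact zero_mem _
  | add D T h ih =>
    rw [SSYT.colWord_add D T h, List.map_cons, List.prod_cons]
    set J := C.join D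
    set E := C.meet D
    have hEJ : E.1 + J.1 = C.1 + D.1 := TableauColumn.meet_add_join C D
    have hE : E.1.firstCol ≤ (J.1 + T).firstCol := by
      rw [SSYT.firstCol_add]
      exact le_inf (TableauColumn.meet_below_join C D)
        (le_trans (α := ℕ → ℕ∞) (TableauColumn.meet_below_right C D) h)
    have h1 := ih J
    have h2 : FreeAlgebra.ι k C * FreeAlgebra.ι k D - FreeAlgebra.ι k E * FreeAlgebra.ι k J ∈
        TwoSidedIdeal.span (columnRelations k n m) :=
      TwoSidedIdeal.subset_span ⟨C, D, E, J, hEJ.symm, rfl⟩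
    rw [← add_assoc, ← hEJ, add_assoc, SSYT.colWord_add E _ hE, List.map_cons, List.prod_cons]
    -- With `w` the word of `T` and `σ` the word of `J + T`: `C D w - E σ = (C D - E J) w + E (J w -
    -- σ)`.
    have h3 := add_mem (TwoSidedIdeal.mul_mem_right _ _ (T.colWord.map (FreeAlgebra.ι k)).prod h2)
      (TwoSidedIdeal.mul_mem_left _ (FreeAlgebra.ι k E) _ h1)
    convert h3 using 1
    noncomm_ring

theorem ι_mul_wordSection_sub_mem (C : TableauColumn n m) (a : TableauxAlgebra k n m) :
    FreeAlgebra.ι k C * wordSection k n m a - wordSection k n m (columnGen k n m C * a) ∈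
      TwoSidedIdeal.span (columnRelations k n m) := by
  induction a using AddMonoidAlgebra.induction_linear with
  | zero => simp
  | add a b ha hb =>
    convert add_mem ha hb using 1
    rw [mul_add, map_add, map_add, mul_add]
    abel
  | single T r =>
    have h := TwoSidedIdeal.mul_mem_left _ (algebraMap k _ r) _
      (ι_mul_wordSection_single_sub_mem k n m C T)
    convert h using 1
    rw [columnGen, single_mul_single, one_mul, wordSection_single, wordSection_single,
      wordSection_single, wordSection_single, one_smul, one_smul, ← Algebra.smul_def, smul_sub,
      mul_smul_comm]

/-- Modulo the binomials every element equals its normal form, which depends only on its image in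
`A`; so elements of the kernel lie in the ideal. -/
theorem sub_wordSection_lift_mem (x : FreeAlgebra k (TableauColumn n m)) :
    x - wordSection k n m (FreeAlgebra.lift k (columnGen k n m) x) ∈
      TwoSidedIdeal.span (columnRelations k n m) := by
  set I := TwoSidedIdeal.span (columnRelations k n m)
  -- Strengthened to left multiplication by `x`, so that the product case composes: only single
  -- letters are ever inserted in front of an already reduced `y`.
  suffices h : ∀ y, y - wordSection k n m (FreeAlgebra.lift k (columnGen k n m) y) ∈ I →
      x * y - wordSection k n m (FreeAlgebra.lift k (columnGen k n m) (x * y)) ∈ I by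
    have h1 := h 1
    rw [mul_one] at h1
    apply h1
    rw [map_one, one_def, wordSection_single, SSYT.colWord_zero]
    simp [I]
  induction x using FreeAlgebra.induction with
  | grade0 r =>
    intro y hy
    rw [← Algebra.smul_def, map_smul, map_smul, ← smul_sub, Algebra.smul_def]
    exact TwoSidedIdeal.mul_mem_left _ _ _ hy
  | grade1 C =>
    intro y hy
    rw [map_mul, FreeAlgebra.lift_ι_apply]
    have h := add_mem (TwoSidedIdeal.mul_mem_left I (FreeAlgebra.ι k C) _ hy)
      (ι_mul_wordSection_sub_mem k n m C (FreeAlgebra.lift k (columnGen k n m) y))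
    rwa [mul_sub, sub_add_sub_cancel] at h
  | mul a b ha hb =>
    intro y hy
    rw [mul_assoc]
    exact ha _ (hb y hy)
  | add a b ha hb =>
    intro y hy
    have h := add_mem (ha y hy) (hb y hy)
    rwa [sub_add_sub_comm, ← map_add, ← map_add, ← add_mul] at h

theorem ker_lift_columnGen :
    TwoSidedIdeal.ker (FreeAlgebra.lift k (columnGen k n m)) =
      TwoSidedIdeal.span (columnRelations k n m) := by
  apply le_antisymm
  · intro x hx
    rw [TwoSidedIdeal.mem_ker] at hx
    simpa [hx] using sub_wordSection_lift_mem k n m x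
  · rw [TwoSidedIdeal.span_le]
    rintro _ ⟨C₁, C₂, C₃, C₄, h, rfl⟩
    rw [SetLike.mem_coe, TwoSidedIdeal.mem_ker, map_sub, map_mul, map_mul]
    simp only [FreeAlgebra.lift_ι_apply, columnGen_mul_columnGen, h, sub_self]

theorem isQuadraticPresentation_columnGen : IsQuadraticPresentation k (columnGen k n m) := by
  refine ⟨inferInstance, lift_columnGen_surjective k n m, columnRelations k n m, ?_,
    ker_lift_columnGen k n m⟩
  rintro _ ⟨C₁, C₂, C₃, C₄, -, rfl⟩
  exact sub_mem (Submodule.subset_span ⟨C₁, C₂, rfl⟩) (Submodule.subset_span ⟨C₃, C₄, rfl⟩)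

variable {n m} in
-- Products of columns are basis elements, so lying in the span means equality with one smaller
-- product. If `C` is not below `D`, the meet and join give one. If it is, `C ⋆ D = E ⋆ F` forces
-- `C` below `E`, so a smaller pair has `E = C`, and then `F = D` by cancellation.
theorem isNormalPair_columnGen_iff (C D : TableauColumn n m) :
    IsNormalPair k (columnGen k n m) C D ↔ TableauColumn.Below C D := by
  have hset : {t | ∃ E F : TableauColumn n m, toLex (E, F) < toLex (C, D) ∧
      t = columnGen k n m E * columnGen k n m F} =
      (fun T : SSYT n m => (single T 1 : TableauxAlgebra k n m)) ''
        {T | ∃ E F : TableauColumn n m, toLex (E, F) < toLex (C, D) ∧ T = E.1 + F.1} := by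
    ext t
    constructor
    · rintro ⟨E, F, h, rfl⟩
      exact ⟨E.1 + F.1, ⟨E, F, h, rfl⟩, (columnGen_mul_columnGen k n m E F).symm⟩
    · rintro ⟨_, ⟨E, F, h, rfl⟩, rfl⟩
      exact ⟨E, F, h, (columnGen_mul_columnGen k n m E F).symm⟩
  rw [IsNormalPair, hset, columnGen_mul_columnGen, single_mem_span_single]
  constructor
  · intro h
    by_contra hCD
    refine h ⟨C.meet D, C.join D, Prod.Lex.toLex_lt_toLex.2 (Or.inl ?_),
      (TableauColumn.meet_add_join C D).symm⟩
    exact lt_of_le_of_ne (TableauColumn.meet_below_left C D).le (TableauColumn.meet_ne_left hCD)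
  · rintro h ⟨E, F, hlt, heq⟩
    have h1 : C.1.firstCol = E.1.firstCol ⊓ F.1.firstCol := by
      rw [← SSYT.firstCol_add, ← heq, SSYT.firstCol_add, inf_eq_left.2 h]
    have h2 : TableauColumn.Below C E := h1.trans_le inf_le_left
    rcases Prod.Lex.toLex_lt_toLex.1 hlt with h3 | ⟨h3, h4⟩
    · exact absurd h2.le (not_le.2 h3)
    · simp only at h3 h4
      subst h3
      exact h4.ne (Subtype.ext (add_left_cancel heq)).symm

theorem isPBWGenerators_columnGen : IsPBWGenerators k (columnGen k n m) := by
  have hN : IsNormalPair k (columnGen k n m) = TableauColumn.Below :=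
    funext₂ fun C D => propext (isNormalPair_columnGen_iff k C D)
  refine ⟨isQuadraticPresentation_columnGen k n m, ?_, ?_⟩
  · rw [hN]
    simp only [prod_map_columnGen]
    have h := (AddMonoidAlgebra.basis (SSYT n m) k).linearIndependent.comp
      (fun s : {s : List (TableauColumn n m) // s.IsChain TableauColumn.Below} =>
        SSYT.wordSum s.1) ?_
    · have h1 : (fun s : {s : List (TableauColumn n m) // s.IsChain TableauColumn.Below} =>
          (single (SSYT.wordSum s.1) 1 : TableauxAlgebra k n m)) =
          AddMonoidAlgebra.basis (SSYT n m) k ∘ fun s => SSYT.wordSum s.1 := by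
        funext s
        simp
      rw [h1]
      exact h
    · rintro ⟨s, hs⟩ ⟨t, ht⟩ h
      refine Subtype.ext ?_
      simpa only [SSYT.colWord_wordSum_of_isChain _ hs, SSYT.colWord_wordSum_of_isChain _ ht] using
        congrArg SSYT.colWord h
  · rw [hN, eq_top_iff]
    rintro a -
    induction a using AddMonoidAlgebra.induction_linear with
    | zero => exact zero_mem _
    | add a b ha hb => exact add_mem ha hb
    | single T r =>
      rw [single_eq_smul_prod]
      exact Submodule.smul_mem _ _ (Submodule.subset_span ⟨⟨T.colWord, T.isChain_colWord⟩, rfl⟩)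

end Presentation

/-! ### The graded reverse lexicographic order -/

/-- The exponents of monomials, ordered by the graded reverse lexicographic order. -/
def GradedRevLex (X : Type*) : Type _ := X →₀ ℕ

namespace GradedRevLex

variable {X : Type*}

noncomputable instance : AddCommMonoid (GradedRevLex X) := inferInstanceAs (AddCommMonoid (X →₀ ℕ))

/-- The identity map from exponents to exponents with the graded reverse lexicographic order. -/
noncomputable def of : (X →₀ ℕ) ≃+ GradedRevLex X := AddEquiv.refl _

/-- The sort key of an exponent: the total degree, then the negated exponents. -/
noncomputable def key (a : GradedRevLex X) : ℕ ×ₗ Lex (X →₀ ℤ) :=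
  toLex (Finsupp.degree (of.symm a),
    toLex (-(Finsupp.mapRange.addMonoidHom (Nat.castAddMonoidHom ℤ) (of.symm a))))

theorem key_add (a b : GradedRevLex X) : key (a + b) = key a + key b := by
  simp only [key, map_add, neg_add]
  rfl

theorem key_injective : Function.Injective (key (X := X)) := by
  intro a b h
  have h1 := congrArg (fun x => ofLex (ofLex x).2) h
  simp only [key, ofLex_toLex, neg_inj] at h1
  apply of.symm.injective
  ext x
  have := DFunLike.congr_fun h1 x
  simpa using this

variable [LinearOrder X]

noncomputable instance : LinearOrder (GradedRevLex X) := LinearOrder.lift' key key_injective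

instance : IsOrderedAddMonoid (GradedRevLex X) :=
  Function.Injective.isOrderedAddMonoid key key_add Iff.rfl

theorem of_monotone : Monotone (of (X := X)) := by
  intro a b h
  obtain ⟨c, rfl⟩ := exists_add_of_le h
  change key (of a) ≤ key (of (a + c))
  rw [key, key, Prod.Lex.toLex_le_toLex]
  simp only [AddEquiv.symm_apply_apply, map_add]
  by_cases hc : Finsupp.degree c = 0
  · have : c = 0 := (Finsupp.degree_eq_zero_iff c).1 hc
    subst this
    simp
  · exact Or.inl (by omega)

/-- The graded reverse lexicographic order, in which the least variable weighs most. -/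
noncomputable def monomialOrder (X : Type w) [LinearOrder X] [Finite X] :
    MonomialOrder.{w, w} X where
  syn := GradedRevLex X
  toSyn := of
  toSyn_monotone := of_monotone
  wellFoundedLT_syn :=
    -- Dickson's lemma: the componentwise order on exponents is a well-quasi-order, a property that
    -- passes to monotone images.
    haveI := of_monotone.wellQuasiOrderedLE_of_wellQuasiOrderedLE_of_surjective
      (of (X := X)).surjective
    WellQuasiOrderedLE.to_wellFoundedLT

/-- The degrees agree, and the least variable at which the exponents differ is `c`, which occurs
only on the left; its exponent counts negatively. -/
theorem pair_lt_pair [Finite X] {a b c d : X} (ha : c < a) (hb : c < b) (hd : c ≤ d) :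
    (monomialOrder X).toSyn (Finsupp.single c 1 + Finsupp.single d 1) <
      (monomialOrder X).toSyn (Finsupp.single a 1 + Finsupp.single b 1) := by
  change key (of (Finsupp.single c 1 + Finsupp.single d 1)) <
    key (of (Finsupp.single a 1 + Finsupp.single b 1))
  rw [key, key, Prod.Lex.toLex_lt_toLex]
  refine Or.inr ⟨by simp, c, fun x hx => ?_, ?_⟩
  · have h1 : x ≠ a := (hx.trans ha).ne
    have h2 : x ≠ b := (hx.trans hb).ne
    have h3 : x ≠ d := (hx.trans_le hd).ne
    simp [h1.symm, h2.symm, h3.symm, hx.ne']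
  · simp [Finsupp.single_apply, ha.ne', hb.ne']
    -- The exponent of `c` on the left is `2` or `1`, according to whether `d = c`.
    split_ifs <;> norm_num

end GradedRevLex

/-! ### A quadratic Gröbner basis -/

namespace SSYT

variable {n m : ℕ}

/-- The product of a multiset of columns. -/
def multisetSum (s : Multiset (TableauColumn n m)) : SSYT n m := (s.map fun C => C.1).sum

theorem multisetSum_cons (C : TableauColumn n m) (s : Multiset (TableauColumn n m)) :
    multisetSum (C ::ₘ s) = C.1 + multisetSum s := by
  rw [multisetSum, Multiset.map_cons, Multiset.sum_cons, multisetSum]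

theorem multisetSum_add (s t : Multiset (TableauColumn n m)) :
    multisetSum (s + t) = multisetSum s + multisetSum t := by
  rw [multisetSum, Multiset.map_add, Multiset.sum_add, multisetSum, multisetSum]

theorem le_firstCol_multisetSum {C : TableauColumn n m} {s : Multiset (TableauColumn n m)}
    (h : ∀ D ∈ s, TableauColumn.Below C D) : C.1.firstCol ≤ (multisetSum s).firstCol := by
  induction s using Multiset.induction with
  | empty => exact firstCol_zero (n := n) (m := m) ▸ le_top
  | cons D s ih =>
    rw [multisetSum_cons, firstCol_add]
    exact le_inf (h D (Multiset.mem_cons_self D s)) (ih fun E hE => h E (Multiset.mem_cons_of_mem hE))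

/-- The columns in the multiset are pairwise comparable in the lattice order. -/
def IsMultichain (s : Multiset (TableauColumn n m)) : Prop :=
  ∀ C ∈ s, ∀ D ∈ s, TableauColumn.Below C D ∨ TableauColumn.Below D C

/-- Take the minimum in the linear extension: being comparable to every member in the lattice order,
it lies below all of them there too. -/
theorem IsMultichain.exists_eq_cons {s : Multiset (TableauColumn n m)} (hs : IsMultichain s)
    (h0 : s ≠ 0) : ∃ C t, s = C ::ₘ t ∧ IsMultichain t ∧ C.1.firstCol ≤ (multisetSum t).firstCol := by
  classical
  have hne : s.toFinset.Nonempty := by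
    obtain ⟨a, ha⟩ := Multiset.exists_mem_of_ne_zero h0
    exact ⟨a, Multiset.mem_toFinset.2 ha⟩
  set C := s.toFinset.min' hne with hC
  have hCs : C ∈ s := Multiset.mem_toFinset.1 (s.toFinset.min'_mem hne)
  have hle : ∀ D ∈ s, TableauColumn.Below C D := fun D hD => by
    rcases hs C hCs D hD with h | h
    · exact h
    · rw [hC.trans_le (s.toFinset.min'_le D (Multiset.mem_toFinset.2 hD)) |>.antisymm h.le]
      exact TableauColumn.Below.refl D
  obtain ⟨t, ht⟩ := Multiset.exists_cons_of_mem hCs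
  refine ⟨C, t, ht, fun D hD E hE => ?_, le_firstCol_multisetSum fun D hD => ?_⟩
  · exact hs D (ht ▸ Multiset.mem_cons_of_mem hD) E (ht ▸ Multiset.mem_cons_of_mem hE)
  · exact hle D (ht ▸ Multiset.mem_cons_of_mem hD)

/-- A multichain is the multiset of columns of its product: its least member is the first column,
and cancellation reduces to the rest. -/
theorem IsMultichain.eq_of_multisetSum_eq {s t : Multiset (TableauColumn n m)}
    (hs : IsMultichain s) (ht : IsMultichain t) (h : multisetSum s = multisetSum t) : s = t := by
  have key : ∀ (T : SSYT n m) (s : Multiset (TableauColumn n m)), IsMultichain s →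
      multisetSum s = T → s = T.colWord := by
    intro T
    induction T using colInduction with
    | zero =>
      intro s _ h
      rw [colWord_zero, Multiset.coe_nil]
      by_contra h0
      obtain ⟨C, hC⟩ := Multiset.exists_mem_of_ne_zero h0
      obtain ⟨t, rfl⟩ := Multiset.exists_cons_of_mem hC
      rw [multisetSum_cons] at h
      exact C.numCols_add_ne_zero _ (h ▸ numCols_zero)
    | add C T hCT ih =>
      intro s hs h
      have h0 : s ≠ 0 := by
        rintro rfl
        exact C.numCols_add_ne_zero T (h ▸ numCols_zero)
      obtain ⟨D, t, rfl, ht, hD⟩ := hs.exists_eq_cons h0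
      rw [multisetSum_cons] at h
      have h1 : D = C := TableauColumn.firstCol_injective_iff.1 (by
        rw [← inf_eq_left.2 hD, ← firstCol_add, h, firstCol_add, inf_eq_left.2 hCT])
      subst h1
      rw [colWord_add D T hCT, ← Multiset.cons_coe, ih t ht (add_left_cancel h)]
  rw [key _ s hs rfl, key _ t ht h.symm]

end SSYT

section Groebner

open AddMonoidAlgebra MvPolynomial

variable (k : Type u) [Field k] {n m : ℕ}

/-- The product of the columns in a monomial. -/
noncomputable def monomialSum (e : TableauColumn n m →₀ ℕ) : SSYT n m :=
  SSYT.multisetSum (Finsupp.toMultiset e)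

theorem monomialSum_add (e e' : TableauColumn n m →₀ ℕ) :
    monomialSum (e + e') = monomialSum e + monomialSum e' := by
  rw [monomialSum, map_add, SSYT.multisetSum_add, monomialSum, monomialSum]

theorem monomialSum_single (C : TableauColumn n m) :
    monomialSum (Finsupp.single C 1) = C.1 := by
  simp [monomialSum, SSYT.multisetSum]

theorem aeval_columnGen_monomial (e : TableauColumn n m →₀ ℕ) (r : k) :
    aeval (columnGen k n m) (monomial e r) = single (monomialSum e) r := by
  have h : ∀ s : Multiset (TableauColumn n m),
      (s.map (columnGen k n m)).prod = single (SSYT.multisetSum s) 1 := by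
    intro s
    induction s using Multiset.induction with
    | empty => rfl
    | cons C s ih =>
      rw [Multiset.map_cons, Multiset.prod_cons, ih, SSYT.multisetSum_cons, columnGen,
        single_mul_single, one_mul]
  rw [aeval_monomial, ← Algebra.smul_def, monomialSum, ← mul_one r, ← smul_single', ← h,
    Finsupp.toMultiset_map, Finsupp.prod_toMultiset, mul_one,
    Finsupp.prod_mapDomain_index (fun _ => pow_zero _) (fun _ _ _ => pow_add _ _ _)]

theorem aeval_columnGen_surjective :
    Function.Surjective (aeval (columnGen k n m) : MvPolynomial (TableauColumn n m) k →ₐ[k] _) := by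
  intro a
  induction a using AddMonoidAlgebra.induction_linear with
  | zero => exact ⟨0, map_zero _⟩
  | add a b ha hb =>
    obtain ⟨x, rfl⟩ := ha
    obtain ⟨y, rfl⟩ := hb
    exact ⟨x + y, map_add _ _ _⟩
  | single T r =>
    refine ⟨r • (T.colWord.map X).prod, ?_⟩
    rw [map_smul, map_list_prod, List.map_map, single_eq_smul_prod]
    congr 3
    funext C
    exact aeval_X _ _

variable {k} in
-- Monomials map to basis elements of `A`, so a term of a relation can only be cancelled by another
-- one with the same image.
theorem exists_ne_monomialSum_eq {f : MvPolynomial (TableauColumn n m) k}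
    (hf : aeval (columnGen k n m) f = 0) {e : TableauColumn n m →₀ ℕ} (he : e ∈ f.support) :
    ∃ e' ∈ f.support, e' ≠ e ∧ monomialSum e' = monomialSum e := by
  classical
  by_contra! hc
  have h1 := congrArg (fun a : TableauxAlgebra k n m => a.coeff (monomialSum e)) hf
  rw [f.as_sum, map_sum, AddMonoidAlgebra.coeff_sum, Finsupp.finsetSum_apply, Finset.sum_eq_single e] at h1
  · rw [aeval_columnGen_monomial] at h1
    exact (MvPolynomial.mem_support_iff.1 he) (by simpa using h1)
  · intro e' he' hne
    rw [aeval_columnGen_monomial, coeff_single]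
    exact Finsupp.single_eq_of_ne (hc e' he' hne).symm
  · exact fun h => absurd he h

/-- The quadratic binomial of two columns. -/
noncomputable def columnBinomial (C D : TableauColumn n m) : MvPolynomial (TableauColumn n m) k :=
  monomial (Finsupp.single C 1 + Finsupp.single D 1) 1 -
    monomial (Finsupp.single (C.meet D) 1 + Finsupp.single (C.join D) 1) 1

theorem aeval_columnBinomial (C D : TableauColumn n m) :
    aeval (columnGen k n m) (columnBinomial k C D) = 0 := by
  rw [columnBinomial, map_sub, aeval_columnGen_monomial, aeval_columnGen_monomial]
  simp only [monomialSum_add, monomialSum_single, TableauColumn.meet_add_join, sub_self]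

theorem columnBinomial_isHomogeneous (C D : TableauColumn n m) :
    (columnBinomial k C D).IsHomogeneous 2 := by
  refine IsHomogeneous.sub (isHomogeneous_monomial _ ?_) (isHomogeneous_monomial _ ?_) <;> simp

theorem meet_join_lt {C D : TableauColumn n m} (h : ¬ C.Below D) (h' : ¬ D.Below C) :
    (GradedRevLex.monomialOrder (TableauColumn n m)).toSyn
        (Finsupp.single (C.meet D) 1 + Finsupp.single (C.join D) 1) <
      (GradedRevLex.monomialOrder (TableauColumn n m)).toSyn
        (Finsupp.single C 1 + Finsupp.single D 1) :=
  GradedRevLex.pair_lt_pair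
    (lt_of_le_of_ne (TableauColumn.meet_below_left C D).le (TableauColumn.meet_ne_left h))
    (lt_of_le_of_ne (TableauColumn.meet_below_right C D).le (TableauColumn.meet_ne_right h'))
    (TableauColumn.meet_below_join C D).le

theorem leadingTerm_columnBinomial {C D : TableauColumn n m} (h : ¬ C.Below D)
    (h' : ¬ D.Below C) :
    (GradedRevLex.monomialOrder (TableauColumn n m)).leadingTerm (columnBinomial k C D) =
      monomial (Finsupp.single C 1 + Finsupp.single D 1) 1 := by
  classical
  have hlt := meet_join_lt h h'
  have hdeg : ∀ e : TableauColumn n m →₀ ℕ,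
      (GradedRevLex.monomialOrder (TableauColumn n m)).degree (monomial e (1 : k)) = e := fun e => by
    rw [MonomialOrder.degree_monomial, if_neg one_ne_zero]
  rw [MonomialOrder.leadingTerm, columnBinomial, MonomialOrder.degree_sub_of_lt (by rwa [hdeg, hdeg]),
    MonomialOrder.leadingCoeff_sub_of_lt (by rwa [hdeg, hdeg]), hdeg,
    MonomialOrder.leadingCoeff_monomial]

theorem exists_pair_le_of_not_isMultichain {e : TableauColumn n m →₀ ℕ}
    (h : ¬ SSYT.IsMultichain (Finsupp.toMultiset e)) :
    ∃ (C D : TableauColumn n m) (e' : TableauColumn n m →₀ ℕ), ¬ C.Below D ∧ ¬ D.Below C ∧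
      e = e' + (Finsupp.single C 1 + Finsupp.single D 1) := by
  simp only [SSYT.IsMultichain, not_forall, not_or] at h
  obtain ⟨C, hC, D, hD, h1, h2⟩ := h
  obtain ⟨s, hs⟩ := Multiset.exists_cons_of_mem hC
  have hDs : D ∈ s := by
    rw [hs, Multiset.mem_cons] at hD
    exact hD.resolve_left fun h => h1 (h ▸ TableauColumn.Below.refl _)
  obtain ⟨t, rfl⟩ := Multiset.exists_cons_of_mem hDs
  refine ⟨C, D, Multiset.toFinsupp t, h1, h2, Multiset.toFinsupp.symm.injective ?_⟩
  change Finsupp.toMultiset e = Finsupp.toMultiset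
    (Multiset.toFinsupp t + (Finsupp.single C 1 + Finsupp.single D 1))
  simp only [map_add, Multiset.toFinsupp_toMultiset, hs, Finsupp.toMultiset_single, one_smul]
  rw [← Multiset.singleton_add, ← Multiset.singleton_add D]
  abel

/-- Replacing an incomparable pair by its meet and join keeps the product and lowers the monomial;
the order is well-founded. -/
theorem exists_multichain_le (e : TableauColumn n m →₀ ℕ) :
    ∃ e' : TableauColumn n m →₀ ℕ, SSYT.IsMultichain (Finsupp.toMultiset e') ∧
      monomialSum e' = monomialSum e ∧ (GradedRevLex.monomialOrder (TableauColumn n m)).toSyn e' ≤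
        (GradedRevLex.monomialOrder (TableauColumn n m)).toSyn e := by
  set o := GradedRevLex.monomialOrder (TableauColumn n m)
  induction hx : o.toSyn e using WellFoundedLT.induction generalizing e with
  | ind x ih =>
    subst hx
    by_cases he : SSYT.IsMultichain (Finsupp.toMultiset e)
    · exact ⟨e, he, rfl, le_rfl⟩
    · obtain ⟨C, D, d, h1, h2, rfl⟩ := exists_pair_le_of_not_isMultichain he
      have hlt : o.toSyn (d + (Finsupp.single (C.meet D) 1 + Finsupp.single (C.join D) 1)) <
          o.toSyn (d + (Finsupp.single C 1 + Finsupp.single D 1)) := by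
        rw [map_add, map_add o.toSyn d]
        exact add_lt_add_right (meet_join_lt h1 h2) _
      obtain ⟨e', h3, h4, h5⟩ := ih _ hlt _ rfl
      refine ⟨e', h3, h4.trans ?_, h5.trans hlt.le⟩
      simp only [monomialSum_add, monomialSum_single, TableauColumn.meet_add_join]

/-- Another monomial of `f` has the same product as the leading one. Its reduction to a multichain
would be the leading monomial itself, by uniqueness, making the latter no larger than the former: a
contradiction. -/
theorem not_isMultichain_degree {f : MvPolynomial (TableauColumn n m) k} (hf0 : f ≠ 0)
    (hf : aeval (columnGen k n m) f = 0) :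
    ¬ SSYT.IsMultichain (Finsupp.toMultiset
      ((GradedRevLex.monomialOrder (TableauColumn n m)).degree f)) := by
  set o := GradedRevLex.monomialOrder (TableauColumn n m)
  intro h
  obtain ⟨e, he, hne, hsum⟩ := exists_ne_monomialSum_eq hf (o.degree_mem_support hf0)
  obtain ⟨e', h1, h2, h3⟩ := exists_multichain_le e
  have h4 : e' = o.degree f :=
    Multiset.toFinsupp.symm.injective (h1.eq_of_multisetSum_eq h (h2.trans hsum))
  subst h4
  exact hne (o.toSyn.injective (le_antisymm (o.le_degree he) h3))

variable (n m) in
theorem isGQuadraticPresentation_columnGen : IsGQuadraticPresentation k (columnGen k n m) := by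
  refine ⟨inferInstance, aeval_columnGen_surjective k, GradedRevLex.monomialOrder _,
    {f | ∃ C D : TableauColumn n m, ¬ C.Below D ∧ ¬ D.Below C ∧ f = columnBinomial k C D},
    ?_, ?_, le_antisymm ?_ ?_⟩
  · rintro _ ⟨C, D, -, -, rfl⟩
    exact aeval_columnBinomial k C D
  · rintro _ ⟨C, D, -, -, rfl⟩
    exact columnBinomial_isHomogeneous k C D
  · refine Ideal.span_mono (Set.image_mono ?_)
    rintro _ ⟨C, D, -, -, rfl⟩
    exact aeval_columnBinomial k C D
  · rw [Ideal.span_le]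
    rintro _ ⟨f, hf, rfl⟩
    by_cases hf0 : f = 0
    · rw [hf0, MonomialOrder.leadingTerm_zero]
      exact zero_mem _
    · obtain ⟨C, D, e, h1, h2, he⟩ :=
        exists_pair_le_of_not_isMultichain (not_isMultichain_degree k hf0 hf)
      -- The complementary monomial, scaled by the leading coefficient of `f`, carries the leading
      -- term of the binomial to that of `f`.
      have h3 := Ideal.mul_mem_left _
        (monomial e ((GradedRevLex.monomialOrder (TableauColumn n m)).leadingCoeff f))
        (Ideal.subset_span (Set.mem_image_of_mem
          (GradedRevLex.monomialOrder (TableauColumn n m)).leadingTerm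
          (show columnBinomial k C D ∈ {f | ∃ C D : TableauColumn n m,
            ¬ C.Below D ∧ ¬ D.Below C ∧ f = columnBinomial k C D} from ⟨C, D, h1, h2, rfl⟩)))
      rw [leadingTerm_columnBinomial k h1 h2, monomial_mul, mul_one, ← he] at h3
      exact h3

end Groebner

/-! ### Linear quotients and the linear resolution -/

section Koszul

open AddMonoidAlgebra

variable {k : Type u} [Field k] {n m : ℕ}

/-- All tableaux that occur in `a` have their first column in `S`. If `S` is closed under passing to
smaller columns, these `a` form the ideal generated by `S`. -/
def HeadsIn (S : Set (TableauColumn n m)) (a : TableauxAlgebra k n m) : Prop :=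
  ∀ T ∈ a.coeff.support, ∃ C ∈ S, C.1.firstCol = T.firstCol

theorem columnGen_mem_columnGrading (C : TableauColumn n m) :
    columnGen k n m C ∈ columnGrading k n m 1 := by
  have h := single_mem_gradeBy (R := k) (SSYT.numColsHom n m) C.1 1
  rwa [show SSYT.numColsHom n m C.1 = 1 from C.2] at h

/-- Each tableau of `a` is its first column times its tail. The support condition excludes
cancellation among the summands, so the coefficients inherit vanishing and homogeneity from `a`. -/
theorem HeadsIn.exists_eq_linearCombination {S : Set (TableauColumn n m)}
    {a : TableauxAlgebra k n m} (h : HeadsIn S a) :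
    ∃ q : S →₀ TableauxAlgebra k n m,
      Finsupp.linearCombination (TableauxAlgebra k n m) (fun C : S => columnGen k n m C.1) q = a ∧
      ∀ C : S, ∀ T ∈ (q C).coeff.support, C.1.1 + T ∈ a.coeff.support := by
  classical
  induction a using AddMonoidAlgebra.induction with
  | zero => exact ⟨0, map_zero _, by simp⟩
  | single_add T r a hT hr ih =>
    have hsupp : (single T r + a).coeff.support = {T} ∪ a.coeff.support := by
      rw [coeff_add, coeff_single, Finsupp.support_add_eq, Finsupp.support_single _ hr]
      rwa [Finsupp.support_single _ hr, Finset.disjoint_singleton_left]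
    obtain ⟨q, hq, hq'⟩ := ih fun U hU => h U (by rw [hsupp]; exact Finset.mem_union_right _ hU)
    obtain ⟨C, hC, hCT⟩ := h T (by rw [hsupp]; exact Finset.mem_union_left _ (by simp))
    have h0 : T.numCols ≠ 0 := fun h0 => C.firstCol_ne_top (by
      rw [hCT, SSYT.eq_zero_of_numCols h0, SSYT.firstCol_zero])
    have hhead : T.head h0 = C :=
      TableauColumn.firstCol_injective_iff.1 ((T.firstCol_head h0).trans hCT.symm)
    have hsum : C.1 + T.tail = T := hhead ▸ T.head_add_tail h0
    refine ⟨Finsupp.single ⟨C, hC⟩ (single T.tail r) + q, ?_, fun D U hU => ?_⟩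
    · rw [map_add, hq, Finsupp.linearCombination_single, smul_eq_mul, columnGen,
        single_mul_single, mul_one, add_comm T.tail, hsum]
    · rw [hsupp]
      rw [Finsupp.add_apply, coeff_add] at hU
      rcases Finset.mem_union.1 (Finsupp.support_add hU) with hU₁ | hU₂
      · refine Finset.mem_union_left _ ?_
        rw [Finsupp.single_apply] at hU₁
        split_ifs at hU₁ with hD
        · have hUT : U = T.tail := by simpa using Finsupp.support_single_subset hU₁
          rw [hUT, ← hD, Finset.mem_singleton]
          exact hsum
        · simp at hU₁
      · exact Finset.mem_union_right _ (hq' D U hU₂)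

variable (k n m) in
/-- A submodule of a free module on a finite linearly ordered set `B`, whose ideal of leading
coefficients at `b` is generated by the columns in a lower set `S b`, where these columns are the
leading coefficients of elements with linear entries. -/
structure LinearSyzygies where
  B : Type u
  [linearOrder : LinearOrder B]
  [finite : Finite B]
  S : B → Set (TableauColumn n m)
  K : Submodule (TableauxAlgebra k n m) (B →₀ TableauxAlgebra k n m)
  lower : ∀ b C D, TableauColumn.Below C D → D ∈ S b → C ∈ S b
  headsIn : ∀ z ∈ K, ∀ b, (∀ b', b < b' → z b' = 0) → HeadsIn (S b) (z b)
  exists_lift : ∀ b, ∀ C ∈ S b, ∃ g ∈ K, (∀ b', b < b' → g b' = 0) ∧ g b = columnGen k n m C ∧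
    ∀ b', g b' ∈ columnGrading k n m 1

namespace LinearSyzygies

attribute [instance] linearOrder finite

variable (M : LinearSyzygies k n m)

/-- The basis of the next free module: the pairs of a basis element and a column that is a leading
coefficient there, ordered lexicographically. -/
def Pairs : Type u := {p : M.B ×ₗ TableauColumn n m // (ofLex p).2 ∈ M.S (ofLex p).1}

noncomputable instance : LinearOrder M.Pairs :=
  inferInstanceAs (LinearOrder {p : M.B ×ₗ TableauColumn n m // (ofLex p).2 ∈ M.S (ofLex p).1})

instance : Finite M.Pairs :=
  haveI : Finite (M.B ×ₗ TableauColumn n m) := inferInstanceAs (Finite (M.B × TableauColumn n m))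
  inferInstanceAs (Finite {p : M.B ×ₗ TableauColumn n m // (ofLex p).2 ∈ M.S (ofLex p).1})

variable {M}

/-- The pair of a basis element and a column. -/
def Pairs.mk (b : M.B) (C : TableauColumn n m) (h : C ∈ M.S b) : M.Pairs := ⟨toLex (b, C), h⟩

/-- The basis element of a pair. -/
def Pairs.fst (p : M.Pairs) : M.B := (ofLex p.1).1

/-- The column of a pair. -/
def Pairs.snd (p : M.Pairs) : TableauColumn n m := (ofLex p.1).2

theorem Pairs.snd_mem (p : M.Pairs) : p.snd ∈ M.S p.fst := p.2

theorem Pairs.lt_iff {p q : M.Pairs} : p < q ↔ p.fst < q.fst ∨ p.fst = q.fst ∧ p.snd < q.snd :=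
  Prod.Lex.toLex_lt_toLex

/-- A chosen element with linear entries and leading term `p.snd` at `p.fst`. -/
noncomputable def lead (p : M.Pairs) : M.B →₀ TableauxAlgebra k n m :=
  (M.exists_lift p.fst p.snd p.snd_mem).choose

theorem lead_mem (p : M.Pairs) : lead p ∈ M.K :=
  (M.exists_lift p.fst p.snd p.snd_mem).choose_spec.1

theorem lead_apply_of_lt (p : M.Pairs) {b : M.B} (h : p.fst < b) : lead p b = 0 :=
  (M.exists_lift p.fst p.snd p.snd_mem).choose_spec.2.1 b h

theorem lead_apply_fst (p : M.Pairs) : lead p p.fst = columnGen k n m p.snd :=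
  (M.exists_lift p.fst p.snd p.snd_mem).choose_spec.2.2.1

theorem lead_apply_mem (p : M.Pairs) (b : M.B) : lead p b ∈ columnGrading k n m 1 :=
  (M.exists_lift p.fst p.snd p.snd_mem).choose_spec.2.2.2 b

variable (M) in
/-- The map from the free module on the pairs that maps a pair to its chosen element. -/
noncomputable def diff :
    (M.Pairs →₀ TableauxAlgebra k n m) →ₗ[TableauxAlgebra k n m] (M.B →₀ TableauxAlgebra k n m) :=
  Finsupp.linearCombination _ lead

theorem diff_single (p : M.Pairs) (a : TableauxAlgebra k n m) :
    M.diff (Finsupp.single p a) = a • lead p := Finsupp.linearCombination_single _ _ _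

theorem diff_single_one_apply_mem (p : M.Pairs) (b : M.B) :
    M.diff (Finsupp.single p 1) b ∈ columnGrading k n m 1 := by
  rw [diff_single, one_smul]
  exact lead_apply_mem p b

theorem diff_mem (y : M.Pairs →₀ TableauxAlgebra k n m) : M.diff y ∈ M.K := by
  rw [diff, Finsupp.linearCombination_apply]
  exact Submodule.sum_mem _ fun p _ => Submodule.smul_mem _ _ (lead_mem p)

theorem diff_apply (y : M.Pairs →₀ TableauxAlgebra k n m) (b : M.B) :
    M.diff y b = ∑ p ∈ y.support, y p * lead p b := by
  rw [diff, Finsupp.linearCombination_apply, Finsupp.sum, Finsupp.finsetSum_apply]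
  rfl

theorem diff_apply_mem {e : ℕ} {y : M.Pairs →₀ TableauxAlgebra k n m}
    (h : ∀ p, y p ∈ columnGrading k n m e) (b : M.B) :
    M.diff y b ∈ columnGrading k n m (e + 1) := by
  rw [diff_apply]
  exact Submodule.sum_mem _ fun p _ => SetLike.mul_mem_graded (h p) (lead_apply_mem p b)

/-- An element of the submodule whose entries beyond `b` vanish agrees at `b` with the image of an
element supported over `b`. -/
theorem exists_diff_apply_eq {z : M.B →₀ TableauxAlgebra k n m} (hz : z ∈ M.K) (b : M.B)
    (hb : ∀ b', b < b' → z b' = 0) :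
    ∃ y : M.Pairs →₀ TableauxAlgebra k n m, M.diff y b = z b ∧
      (∀ b', b < b' → M.diff y b' = 0) ∧ (∀ p, p.fst ≠ b → y p = 0) ∧ (z b = 0 → y = 0) ∧
      ∀ e, z b ∈ columnGrading k n m (e + 1) → ∀ p, y p ∈ columnGrading k n m e := by
  classical
  obtain ⟨q, hq, hq'⟩ := (M.headsIn z hz b hb).exists_eq_linearCombination
  let ι : M.S b ↪ M.Pairs := ⟨fun C => Pairs.mk b C.1 C.2, fun C D h =>
    Subtype.ext (congrArg Pairs.snd h)⟩
  have hι : ∀ p : M.Pairs, q.embDomain ι p ≠ 0 → ∃ C, p = ι C ∧ q.embDomain ι p = q C := by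
    intro p hp
    by_cases h : p ∈ Set.range ι
    · obtain ⟨C, rfl⟩ := h
      exact ⟨C, rfl, Finsupp.embDomain_apply_self _ _ _⟩
    · exact absurd (Finsupp.embDomain_of_notMem_range _ _ _ h) hp
  have hd : ∀ b', M.diff (q.embDomain ι) b' = ∑ C ∈ q.support, q C * lead (ι C) b' := by
    intro b'
    rw [diff_apply, Finsupp.support_embDomain, Finset.sum_map]
    simp only [Finsupp.embDomain_apply_self]
  refine ⟨q.embDomain ι, ?_, fun b' hb' => ?_, fun p hp => ?_, fun h0 => ?_, fun e he p => ?_⟩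
  · rw [hd, ← hq, Finsupp.linearCombination_apply, Finsupp.sum]
    exact Finset.sum_congr rfl fun C _ => congrArg (q C * ·) (lead_apply_fst (ι C))
  · rw [hd]
    exact Finset.sum_eq_zero fun C _ => by rw [lead_apply_of_lt (ι C) hb', mul_zero]
  · by_contra h
    obtain ⟨C, rfl, -⟩ := hι p h
    exact hp rfl
  · have : q = 0 := by
      ext1 C
      rw [Finsupp.zero_apply, ← coeff_eq_zero, ← Finsupp.support_eq_empty,
        Finset.eq_empty_iff_forall_notMem]
      intro T hT
      simpa [h0] using hq' C T hT
    rw [this, Finsupp.embDomain_zero]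
  · by_cases h : q.embDomain ι p = 0
    · rw [h]
      exact zero_mem _
    · obtain ⟨C, -, hC⟩ := hι p h
      rw [hC]
      intro T hT
      have h1 := he _ (hq' C T hT)
      rw [map_add, show SSYT.numColsHom n m C.1.1 = 1 from C.1.2] at h1
      omega

/-- Division with remainder: clear the entry at the largest index of the support and recurse. The
two extra clauses, on support and on degree, make the corrections in `exists_lift_ker` lower order
and linear. -/
theorem exists_diff_eq {z : M.B →₀ TableauxAlgebra k n m} (hz : z ∈ M.K) :
    ∃ y : M.Pairs →₀ TableauxAlgebra k n m, M.diff y = z ∧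
      (∀ β, (∀ b, β ≤ b → z b = 0) → ∀ p : M.Pairs, β ≤ p.fst → y p = 0) ∧
      ∀ e, (∀ b, z b ∈ columnGrading k n m (e + 1)) → ∀ p, y p ∈ columnGrading k n m e := by
  classical
  by_cases hz0 : z = 0
  · subst hz0
    exact ⟨0, map_zero _, fun _ _ _ _ => rfl, fun _ _ _ => zero_mem _⟩
  have hne := Finsupp.support_nonempty_iff.2 hz0
  induction hb : z.support.max' hne using WellFoundedLT.induction generalizing z with
  | ind b ih =>
    have hb0 : ∀ b', b < b' → z b' = 0 := fun b' hb' => by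
      by_contra h
      exact absurd (z.support.le_max' b' (Finsupp.mem_support_iff.2 h)) (by rw [hb]; exact not_le.2 hb')
    obtain ⟨y, h1, h2, h3, h4, h5⟩ := exists_diff_apply_eq hz b hb0
    have hz' : z - M.diff y ∈ M.K := sub_mem hz (diff_mem y)
    have hzb : ∀ b', b ≤ b' → (z - M.diff y) b' = 0 := fun b' hb' => by
      rw [Finsupp.sub_apply]
      rcases hb'.eq_or_lt with rfl | hb'
      · rw [h1, sub_self]
      · rw [hb0 b' hb', h2 b' hb', sub_self]
    obtain ⟨y', h1', h2', h3'⟩ : ∃ y' : M.Pairs →₀ TableauxAlgebra k n m,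
        M.diff y' = z - M.diff y ∧
        (∀ β, (∀ b, β ≤ b → (z - M.diff y) b = 0) → ∀ p : M.Pairs, β ≤ p.fst → y' p = 0) ∧
        ∀ e, (∀ b, (z - M.diff y) b ∈ columnGrading k n m (e + 1)) →
          ∀ p, y' p ∈ columnGrading k n m e := by
      by_cases h0 : z - M.diff y = 0
      · rw [h0]
        exact ⟨0, map_zero _, fun _ _ _ _ => rfl, fun _ _ _ => zero_mem _⟩
      · have hne' := Finsupp.support_nonempty_iff.2 h0
        refine ih _ ?_ hz' h0 hne' rfl
        by_contra hlt
        exact Finsupp.mem_support_iff.1 (Finset.max'_mem _ hne') (hzb _ (not_lt.1 hlt))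
    refine ⟨y' + y, by rw [map_add, h1', sub_add_cancel], fun β hβ p hp => ?_, fun e he p => ?_⟩
    · rw [Finsupp.add_apply]
      -- If `β ≤ b`, the entry at `b` vanishes and nothing was subtracted; otherwise `y` is
      -- supported over `b < β`.
      rcases le_or_gt β b with hβb | hβb
      · have hy : y = 0 := h4 (hβ b hβb)
        rw [hy, map_zero, sub_zero] at h2'
        rw [h2' β hβ p hp, hy, Finsupp.zero_apply, add_zero]
      · rw [h2' β (fun b' hb' => hzb b' (hβb.le.trans hb')) p hp,
          h3 p (hβb.trans_le hp).ne', add_zero]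
    · rw [Finsupp.add_apply]
      have hy := h5 e (he b)
      refine add_mem (h3' e (fun b' => ?_) p) (hy p)
      rw [Finsupp.sub_apply]
      exact sub_mem (he b') (diff_apply_mem hy b')

theorem range_diff : (Set.range M.diff) = M.K := by
  ext z
  constructor
  · rintro ⟨y, rfl⟩
    exact diff_mem y
  · intro hz
    obtain ⟨y, hy, -⟩ := exists_diff_eq hz
    exact ⟨y, hy⟩

/-- Compare entries at `p.fst`: pairs over smaller indices contribute nothing, so every `p.snd ⋆ T`
with `T` in `y p` must be some `U ⋆ C'` with `C' < p.snd`. Were `p.snd` below the first column of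
`T`, it would be the first column of the product, hence below `C'`, which is impossible. -/
theorem headsIn_of_diff_eq_zero {y : M.Pairs →₀ TableauxAlgebra k n m} (hy : M.diff y = 0)
    (p : M.Pairs) (hp : ∀ p', p < p' → y p' = 0) :
    HeadsIn {E | ¬ TableauColumn.Below p.snd E} (y p) := by
  classical
  intro T hT
  have h0 : M.diff y p.fst = 0 := by rw [hy, Finsupp.zero_apply]
  have hpy : p ∈ y.support := by
    rw [Finsupp.mem_support_iff]
    intro h
    simp [h] at hT
  rw [diff_apply, ← Finset.add_sum_erase _ _ hpy, lead_apply_fst] at h0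
  -- Multiplication by a column is injective on tableaux, so no terms merge within this product.
  have h1 : p.snd.1 + T ∈ (y p * columnGen k n m p.snd).coeff.support := by
    rw [columnGen, support_coeff_mul_single _ _ (by simp)]
    exact Finset.mem_map.2 ⟨T, hT, add_comm _ _⟩
  rw [add_eq_zero_iff_eq_neg.1 h0, coeff_neg, Finsupp.support_neg, coeff_sum] at h1
  obtain ⟨p', hp', h2⟩ := Finset.mem_biUnion.1 (Finsupp.support_finsetSum h1)
  obtain ⟨hne, hp'⟩ := Finset.mem_erase.1 hp'
  have hlt : p' < p := lt_of_le_of_ne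
    (not_lt.1 fun h => Finsupp.mem_support_iff.1 hp' (hp p' h)) hne
  rcases Pairs.lt_iff.1 hlt with h3 | ⟨h3, h4⟩
  · rw [lead_apply_of_lt p' h3, mul_zero] at h2
    simp at h2
  rw [← h3, lead_apply_fst, columnGen, support_coeff_mul_single _ _ (by simp)] at h2
  obtain ⟨U, -, hU⟩ := Finset.mem_map.1 h2
  have hU' : U + p'.snd.1 = p.snd.1 + T := hU
  have hnot : ¬ p.snd.1.firstCol ≤ T.firstCol := fun h => by
    have h5 : p.snd.1.firstCol = U.firstCol ⊓ p'.snd.1.firstCol := by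
      rw [← SSYT.firstCol_add, hU', SSYT.firstCol_add, inf_eq_left.2 h]
    have h6 : TableauColumn.Below p.snd p'.snd := h5.trans_le inf_le_right
    exact absurd h6.le (not_le.2 h4)
  have hT0 : T.numCols ≠ 0 := fun h => hnot (by
    rw [SSYT.eq_zero_of_numCols h, SSYT.firstCol_zero]
    exact le_top)
  refine ⟨T.head hT0, fun h => hnot ?_, T.firstCol_head hT0⟩
  exact le_trans (α := ℕ → ℕ∞) h (T.firstCol_head hT0).le

/-- With `p = (b, C)`, the relation `E ⋆ C = (C ∨ E) ⋆ (C ∧ E)` cancels the entries at `b` of `E •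
lead (b, C)` and `(C ∨ E) • lead (b, C ∧ E)`. Their difference lies in `K` and is supported below
`b`; it is quadratic, so it is the image of a linear combination of pairs over indices below `b`. -/
theorem exists_lift_ker (p : M.Pairs) (E : TableauColumn n m)
    (hE : ¬ TableauColumn.Below p.snd E) :
    ∃ g ∈ LinearMap.ker M.diff, (∀ p', p < p' → g p' = 0) ∧ g p = columnGen k n m E ∧
      ∀ p', g p' ∈ columnGrading k n m 1 := by
  classical
  let p₀ : M.Pairs := Pairs.mk p.fst (p.snd.meet E)
    (M.lower _ _ _ (TableauColumn.meet_below_left _ _) p.snd_mem)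
  have hp₀ : p₀ < p := Pairs.lt_iff.2 (Or.inr ⟨rfl, lt_of_le_of_ne
    (TableauColumn.meet_below_left _ _).le (TableauColumn.meet_ne_left hE)⟩)
  set x := columnGen k n m E
  set x₀ := columnGen k n m (p.snd.join E)
  have hw : x • lead p - x₀ • lead p₀ ∈ M.K :=
    sub_mem (Submodule.smul_mem _ _ (lead_mem p)) (Submodule.smul_mem _ _ (lead_mem p₀))
  obtain ⟨y, hy, hy0, hy1⟩ := exists_diff_eq hw
  have hy0' : ∀ p' : M.Pairs, p.fst ≤ p'.fst → y p' = 0 := by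
    refine hy0 p.fst fun b hb => ?_
    rw [Finsupp.sub_apply, Finsupp.smul_apply, Finsupp.smul_apply, smul_eq_mul, smul_eq_mul]
    rcases hb.eq_or_lt with rfl | hb
    · rw [lead_apply_fst, show lead p₀ p.fst = _ from lead_apply_fst p₀]
      change columnGen k n m E * columnGen k n m p.snd -
        columnGen k n m (p.snd.join E) * columnGen k n m (p.snd.meet E) = 0
      rw [columnGen_mul_columnGen, columnGen_mul_columnGen, add_comm (p.snd.join E).1,
        TableauColumn.meet_add_join, add_comm, sub_self]
    · rw [lead_apply_of_lt p hb, lead_apply_of_lt p₀ hb, mul_zero, mul_zero, sub_self]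
  -- The difference has degree two and the chosen lifts have degree one, which leaves degree one for
  -- the coefficients.
  have hy1' : ∀ p', y p' ∈ columnGrading k n m 1 := by
    refine hy1 1 fun b => ?_
    rw [Finsupp.sub_apply, Finsupp.smul_apply, Finsupp.smul_apply, smul_eq_mul, smul_eq_mul]
    exact sub_mem
      (SetLike.mul_mem_graded (columnGen_mem_columnGrading E) (lead_apply_mem p b))
      (SetLike.mul_mem_graded (columnGen_mem_columnGrading _) (lead_apply_mem p₀ b))
  refine ⟨Finsupp.single p x - Finsupp.single p₀ x₀ - y, ?_, fun p' hp' => ?_, ?_, fun p' => ?_⟩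
  · rw [LinearMap.mem_ker, map_sub, map_sub, diff_single, diff_single, hy, sub_self]
  · have hfst : p.fst ≤ p'.fst := by
      rcases Pairs.lt_iff.1 hp' with h | h
      · exact h.le
      · exact h.1.le
    rw [Finsupp.sub_apply, Finsupp.sub_apply, Finsupp.single_eq_of_ne hp'.ne',
      Finsupp.single_eq_of_ne (hp₀.trans hp').ne', hy0' p' hfst, sub_self, sub_self]
  · rw [Finsupp.sub_apply, Finsupp.sub_apply, Finsupp.single_eq_same,
      Finsupp.single_eq_of_ne hp₀.ne', hy0' p le_rfl, sub_zero, sub_zero]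
  · rw [Finsupp.sub_apply, Finsupp.sub_apply]
    refine sub_mem (sub_mem ?_ ?_) (hy1' p')
    · rw [Finsupp.single_apply]
      split_ifs
      · exact columnGen_mem_columnGrading _
      · exact zero_mem _
    · rw [Finsupp.single_apply]
      split_ifs
      · exact columnGen_mem_columnGrading _
      · exact zero_mem _

variable (M) in
/-- The syzygies of the chosen elements. -/
noncomputable def next : LinearSyzygies k n m where
  B := M.Pairs
  S p := {E | ¬ TableauColumn.Below p.snd E}
  K := LinearMap.ker M.diff
  lower _ _ _ h h' := fun h'' => h' (h''.trans h)
  headsIn _ hy p hp := headsIn_of_diff_eq_zero hy p hp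
  exists_lift p E hE := exists_lift_ker p E hE

end LinearSyzygies

/-! ### The augmentation and the iterated syzygies -/

variable (k n m) in
theorem columnGrading_zero : columnGrading k n m 0 = 1 := by
  apply le_antisymm
  · intro a ha
    rw [Submodule.mem_one]
    refine ⟨a.coeff 0, ?_⟩
    rw [coe_algebraMap]
    ext T
    by_cases hT : T = 0
    · subst hT
      simp
    · have h0 : a.coeff T = 0 := Finsupp.notMem_support_iff.1 fun h =>
        hT (SSYT.eq_zero_of_numCols (ha T h))
      simp [h0, Ne.symm hT]
  · rw [Submodule.one_le]
    exact SetLike.GradedOne.one_mem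

/-- Only the empty tableau has no columns. With `coeff_zero_of_mem_irrelevant`, this identifies `A₊`
with the elements without constant term. -/
theorem sub_single_zero_mem_irrelevant (a : TableauxAlgebra k n m) :
    a - single 0 (a.coeff 0) ∈ (HomogeneousIdeal.irrelevant (columnGrading k n m)).toIdeal := by
  classical
  induction a using AddMonoidAlgebra.induction_linear with
  | zero => simp
  | add a b ha hb =>
    convert add_mem ha hb using 1
    rw [coeff_add, Finsupp.add_apply, single_add]
    abel
  | single T r =>
    by_cases hT : T.numCols = 0
    · rw [SSYT.eq_zero_of_numCols hT]
      simp
    · have h0 : T ≠ 0 := fun h => hT (h ▸ SSYT.numCols_zero)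
      rw [coeff_single, Finsupp.single_eq_of_ne h0.symm, single_zero, sub_zero]
      exact HomogeneousIdeal.mem_irrelevant_of_mem _ (Nat.pos_of_ne_zero hT)
        (single_mem_gradeBy (SSYT.numColsHom n m) T r)

theorem coeff_zero_of_mem_irrelevant {a : TableauxAlgebra k n m}
    (ha : a ∈ (HomogeneousIdeal.irrelevant (columnGrading k n m)).toIdeal) : a.coeff 0 = 0 := by
  have h := sub_mem ha (sub_single_zero_mem_irrelevant a)
  rw [sub_sub_cancel] at h
  replace h := (HomogeneousIdeal.mem_irrelevant_iff _ _).1 h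
  have h0 : (single 0 (a.coeff 0) : TableauxAlgebra k n m) ∈ columnGrading k n m 0 := by
    have h1 := single_mem_gradeBy (SSYT.numColsHom n m) 0 (a.coeff 0)
    rwa [map_zero] at h1
  have h2 : GradedRing.proj (columnGrading k n m) 0 (single 0 (a.coeff 0)) = single 0 (a.coeff 0) :=
    DirectSum.decompose_of_mem_same _ h0
  rw [h2] at h
  exact single_eq_zero.1 h

variable (k n m) in
/-- The augmentation `A → A ⧸ A₊` on the free module with one generator. -/
noncomputable def augmentation :
    (PUnit.{u + 1} →₀ TableauxAlgebra k n m) →ₗ[TableauxAlgebra k n m]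
      (TableauxAlgebra k n m ⧸ (HomogeneousIdeal.irrelevant (columnGrading k n m)).toIdeal) :=
  Submodule.mkQ _ ∘ₗ Finsupp.lapply PUnit.unit

theorem mem_ker_augmentation {z : PUnit.{u + 1} →₀ TableauxAlgebra k n m} :
    z ∈ LinearMap.ker (augmentation k n m) ↔
      z PUnit.unit ∈ (HomogeneousIdeal.irrelevant (columnGrading k n m)).toIdeal := by
  rw [LinearMap.mem_ker, augmentation, LinearMap.comp_apply, Submodule.mkQ_apply,
    Submodule.Quotient.mk_eq_zero]
  rfl

variable (k n m) in
theorem augmentation_surjective : Function.Surjective (augmentation k n m) := by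
  intro x
  obtain ⟨a, rfl⟩ := Submodule.mkQ_surjective _ x
  exact ⟨Finsupp.single PUnit.unit a, by
    rw [augmentation, LinearMap.comp_apply, Finsupp.lapply_apply, Finsupp.single_eq_same]⟩

variable (k n m) in
/-- The irrelevant ideal as the first module of syzygies. -/
noncomputable def LinearSyzygies.irrelevant : LinearSyzygies k n m where
  B := PUnit
  S _ := Set.univ
  K := LinearMap.ker (augmentation k n m)
  lower _ _ _ _ _ := Set.mem_univ _
  headsIn z hz b _ T hT := by
    have h0 : T.numCols ≠ 0 := fun h => by
      rw [SSYT.eq_zero_of_numCols h] at hT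
      exact Finsupp.mem_support_iff.1 hT
        (coeff_zero_of_mem_irrelevant (mem_ker_augmentation.1 hz))
    exact ⟨T.head h0, Set.mem_univ _, T.firstCol_head h0⟩
  exists_lift b C _ := by
    refine ⟨Finsupp.single PUnit.unit (columnGen k n m C), ?_, fun b' h => ?_, ?_, fun b' => ?_⟩
    · rw [mem_ker_augmentation, Finsupp.single_eq_same]
      exact HomogeneousIdeal.mem_irrelevant_of_mem _ one_pos (columnGen_mem_columnGrading C)
    · exact absurd h (lt_irrefl _)
    · exact Finsupp.single_eq_same
    · exact (Finsupp.single_eq_same (a := PUnit.unit) (b := columnGen k n m C)).symm ▸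
        columnGen_mem_columnGrading C

variable (k n m) in
/-- The iterated syzygies of `A ⧸ A₊`. -/
noncomputable def syzygies : ℕ → LinearSyzygies k n m
  | 0 => LinearSyzygies.irrelevant k n m
  | i + 1 => (syzygies i).next

variable (k n m) in
theorem isKoszul_columnGrading : IsKoszul (columnGrading k n m) := by
  refine ⟨FaithfulSMul.algebraMap_injective k _, columnGrading_zero k n m,
    fun i => (syzygies k n m i).B, fun i => (syzygies k n m i).diff, augmentation k n m,
    fun i p b => LinearSyzygies.diff_single_one_apply_mem (M := syzygies k n m i) p b,
    augmentation_surjective k n m, fun z => ?_, fun i z => ?_⟩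
  -- Exactness is `range_diff` at each stage: by definition `K` is the kernel of the augmentation at
  -- stage `0` and of the preceding differential afterwards.
  · exact (Set.ext_iff.1 (LinearSyzygies.range_diff (M := syzygies k n m 0)) z).symm
  · exact (Set.ext_iff.1 (LinearSyzygies.range_diff (M := syzygies k n m (i + 1))) z).symm

end Koszul

theorem mainTheorem4 (k : Type u) [Field k] [IsAlgClosed k] [CharZero k] (n m : ℕ) (hnm : n ≤ m) :
    IsKoszul (columnGrading k n m) ∧
    (Finite (TableauColumn n m) ∧
      Function.Surjective (FreeAlgebra.lift k (columnGen k n m)) ∧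
      TwoSidedIdeal.ker (FreeAlgebra.lift k (columnGen k n m)) =
        TwoSidedIdeal.span (columnRelations k n m)) ∧
    (∃ _ : LinearOrder (TableauColumn n m), IsPBWGenerators k (columnGen k n m)) ∧
    IsGQuadraticPresentation k (columnGen k n m) :=
  ⟨isKoszul_columnGrading k n m,
    ⟨inferInstance, lift_columnGen_surjective k n m, ker_lift_columnGen k n m⟩,
    ⟨inferInstance, isPBWGenerators_columnGen k n m⟩,
    isGQuadraticPresentation_columnGen k n m⟩
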